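/- A loop is a set with operations $\cdot,\backslash,/$ and a constant $1$ satisfying $x\cdot(x\backslash y)=y=x\backslash(x\cdot y)$, $(x/y)\cdot y=x=(x\cdot y)/y$ and $x\cdot 1=x=1\cdot x$. Let $\mathcal S(\mathsf{Loop})$ and $\mathcal S(\mathsf{Grp})$ be the categories of simplicial loops and of simplicial groups, and let $L=\pi_0\circ\mathcal S(I)\colon \mathcal S(\mathsf{Loop})\to\mathcal S(\mathsf{Grp})\to\mathsf{Grp}$, where $I$ is the reflector from loops to groups (applied degreewise) and $\pi_0$ is the connected components functor; $L$ is left adjoint to the inclusion $D$ that views a group as a discrete simplicial loop. Let $\eta$ be the unit of $L\dashv D$. A regular epimorphism $f\colon E\to B$ of simplicial loops is a *trivial extension* if the square with sides $\eta_E$, $f$, $DL(f)$, $\eta_B$ is a pullback, and a regular epimorphism $p\colon E\to B$ is a *normal extension* if the first projection $\pi_1\colon E\times_BE\to E$ of its kernel pair is a trivial extension. A normal extension $p\colon E\to B$ is *weakly universal* if for every normal extension $p'\colon E'\to B$ there is $u\colon E\to E'$ with $p'u=p$. The fundamental group $\pi_1(B)$ is the Galois group $$\mathrm{Gal}(E,p,0)=\ker\bigl(\langle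 L(\pi_1),L(\pi_2)\rangle\colon L(E\times_BE)\to L(E)\times L(E)\bigr)$$ of a weakly universal normal extension $p\colon E\to B$. For a simplicial loop $A$, let $A_0$ be the connected component of $1$ in $A$, that is, the simplicial subloop of the simplices whose vertices lie in the connected component of the vertex $1$. For a normal subobject $K$ of $A$ (a kernel of some morphism from $A$), let $[K,A,A]$ be the associator, defined degreewise: in degree $n$ it is the normal subloop of $A_n$ generated by the elements $((xy)z)/(x(yz))$ with $x,y,z\in A_n$ at least one of which is in $K_n$. Let $f\colon P\to B$ be a projective presentation of a simplicial loop $B$, that is, a regular epimorphism whose domain $P$ is projective with respect to regular epimorphisms, and let $K$ be the kernel of $f$. Then $B$ has a weakly universal normal extension, $[K,P,P]\vee K_0\le K\wedge([P,P,P]\vee P_0)$, and for every weakly universal normal extension $p\colon E\to B$ there is an isomorphism (of simplicial loops, the group on the left being viewed as a discrete one) $$\pi_1(B)=\mathrm{Gal}(E,p,0)\;\cong\;\frac{K\wedge([P,P,P]\vee P_0)}{[K,P,P]\vee K_0},$$ where $\vee$ and $\wedge$ are the supremum and infimum of normal subobjects (in $P$ for the numerator, in $K$ for $[K,P,P]\vee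 K_0$). -/

import Mathlib

open CategoryTheory CategoryTheory.Limits Opposite
open scoped Simplicial

universe u

/-! ### Loops -/

/-- A loop: a multiplication with unit `1`, left division `ldiv x y = x \ y` and right division
`rdiv x y = x / y`. -/
class AlgLoop (L : Type u) extends MulOneClass L where
  /-- left division, `x \ y` -/
  ldiv : L → L → L
  /-- right division, `x / y` -/
  rdiv : L → L → L
  mul_ldiv : ∀ x y : L, x * ldiv x y = y
  ldiv_mul : ∀ x y : L, ldiv x (x * y) = y
  rdiv_mul : ∀ x y : L, rdiv x y * y = x
  mul_rdiv : ∀ x y : L, rdiv (x * y) y = x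

namespace AlgLoop

attribute [simp] mul_ldiv ldiv_mul rdiv_mul mul_rdiv

section
variable {L M : Type u} [AlgLoop L] [AlgLoop M]

theorem mul_left_cancel' {x y z : L} (h : x * y = x * z) : y = z := by
  rw [← ldiv_mul x y, h, ldiv_mul]

theorem mul_right_cancel' {x y z : L} (h : x * z = y * z) : x = y := by
  rw [← mul_rdiv x z, h, mul_rdiv]

@[simp] theorem ldiv_self (x : L) : ldiv x x = 1 := by
  simpa using ldiv_mul x (1 : L)

@[simp] theorem rdiv_self (x : L) : rdiv x x = 1 := by
  simpa using mul_rdiv (1 : L) x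

/-- A map of loops that preserves the multiplication and the unit preserves both divisions, so that
homomorphisms of loops are the same as the `MonoidHom`s between them. -/
theorem map_ldiv (f : L →* M) (x y : L) : f (ldiv x y) = ldiv (f x) (f y) := by
  apply mul_left_cancel' (x := f x)
  rw [← map_mul, mul_ldiv, mul_ldiv]

theorem map_rdiv (f : L →* M) (x y : L) : f (rdiv x y) = rdiv (f x) (f y) := by
  apply mul_right_cancel' (z := f y)
  rw [← map_mul, rdiv_mul, rdiv_mul]

end

/-- A group is a loop. -/
@[reducible] def ofGroup (G : Type u) [Group G] : AlgLoop G where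
  ldiv x y := x⁻¹ * y
  rdiv x y := x * y⁻¹
  mul_ldiv x y := by simp
  ldiv_mul x y := by simp
  rdiv_mul x y := by simp
  mul_rdiv x y := by simp

end AlgLoop

open AlgLoop

/-- A normal subloop: a subset that contains `1`, is closed under the three operations and is stable
under the inner mappings `T`, `L`, `R` of the loop and under their inverses; equivalently
`xN = Nx`, `x(yN) = (xy)N` and `(Nx)y = N(xy)` for all `x`, `y`. -/
@[ext]
structure NormalSubloop (L : Type u) [AlgLoop L] where
  /-- the underlying set -/
  carrier : Set L
  one_mem : (1 : L) ∈ carrier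
  mul_mem : ∀ {a b}, a ∈ carrier → b ∈ carrier → a * b ∈ carrier
  ldiv_mem : ∀ {a b}, a ∈ carrier → b ∈ carrier → ldiv a b ∈ carrier
  rdiv_mem : ∀ {a b}, a ∈ carrier → b ∈ carrier → rdiv a b ∈ carrier
  innerT_mem : ∀ (x : L) {a}, a ∈ carrier → ldiv x (a * x) ∈ carrier
  innerT_inv_mem : ∀ (x : L) {a}, a ∈ carrier → rdiv (x * a) x ∈ carrier
  innerL_mem : ∀ (x y : L) {a}, a ∈ carrier → ldiv (x * y) (x * (y * a)) ∈ carrier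
  innerL_inv_mem : ∀ (x y : L) {a}, a ∈ carrier → ldiv y (ldiv x ((x * y) * a)) ∈ carrier
  innerR_mem : ∀ (x y : L) {a}, a ∈ carrier → rdiv ((a * x) * y) (x * y) ∈ carrier
  innerR_inv_mem : ∀ (x y : L) {a}, a ∈ carrier → rdiv (rdiv (a * (x * y)) y) x ∈ carrier

namespace NormalSubloop

section
variable {L M : Type u} [AlgLoop L] [AlgLoop M]

instance : Membership L (NormalSubloop L) := ⟨fun N x => x ∈ N.carrier⟩

/-- The class of `1` of a congruence of loops. -/
def ofCongruence (r : L → L → Prop) (hr : Equivalence r)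
    (hmul : ∀ {a b c d}, r a b → r c d → r (a * c) (b * d))
    (hldiv : ∀ {a b c d}, r a b → r c d → r (ldiv a c) (ldiv b d))
    (hrdiv : ∀ {a b c d}, r a b → r c d → r (rdiv a c) (rdiv b d)) : NormalSubloop L where
  carrier := {x | r x 1}
  one_mem := hr.refl 1
  mul_mem ha hb := by simpa using hmul ha hb
  ldiv_mem ha hb := by simpa using hldiv ha hb
  rdiv_mem ha hb := by simpa using hrdiv ha hb
  innerT_mem x a ha := by simpa using hldiv (hr.refl x) (hmul ha (hr.refl x))
  innerT_inv_mem x a ha := by simpa using hrdiv (hmul (hr.refl x) ha) (hr.refl x)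
  innerL_mem x y a ha := by
    simpa using hldiv (hr.refl (x * y)) (hmul (hr.refl x) (hmul (hr.refl y) ha))
  innerL_inv_mem x y a ha := by
    simpa using hldiv (hr.refl y) (hldiv (hr.refl x) (hmul (hr.refl (x * y)) ha))
  innerR_mem x y a ha := by
    simpa using hrdiv (hmul (hmul ha (hr.refl x)) (hr.refl y)) (hr.refl (x * y))
  innerR_inv_mem x y a ha := by
    simpa using hrdiv (hrdiv (hmul ha (hr.refl (x * y))) (hr.refl y)) (hr.refl x)

/-- The inverse image of a normal subloop under a homomorphism. -/
def comap (f : L →* M) (N : NormalSubloop M) : NormalSubloop L where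
  carrier := {x | f x ∈ N.carrier}
  one_mem := by simpa using N.one_mem
  mul_mem ha hb := by simpa using N.mul_mem ha hb
  ldiv_mem ha hb := by simpa [map_ldiv] using N.ldiv_mem ha hb
  rdiv_mem ha hb := by simpa [map_rdiv] using N.rdiv_mem ha hb
  innerT_mem x a ha := by simpa [map_ldiv] using N.innerT_mem (f x) ha
  innerT_inv_mem x a ha := by simpa [map_rdiv] using N.innerT_inv_mem (f x) ha
  innerL_mem x y a ha := by simpa [map_ldiv] using N.innerL_mem (f x) (f y) ha
  innerL_inv_mem x y a ha := by simpa [map_ldiv] using N.innerL_inv_mem (f x) (f y) ha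
  innerR_mem x y a ha := by simpa [map_rdiv] using N.innerR_mem (f x) (f y) ha
  innerR_inv_mem x y a ha := by simpa [map_rdiv] using N.innerR_inv_mem (f x) (f y) ha

/-- The kernel of a homomorphism of loops. -/
def ker (f : L →* M) : NormalSubloop L :=
  ofCongruence (fun x y => f x = f y) ⟨fun _ => rfl, fun h => h.symm, fun h h' => h.trans h'⟩
    (fun h h' => by simp [h, h']) (fun h h' => by simp [map_ldiv, h, h'])
    (fun h h' => by simp [map_rdiv, h, h'])

/-- The intersection of a family of normal subloops. -/
def sInf (S : Set (NormalSubloop L)) : NormalSubloop L where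
  carrier := {x | ∀ N ∈ S, x ∈ N}
  one_mem N _ := N.one_mem
  mul_mem ha hb N h := N.mul_mem (ha N h) (hb N h)
  ldiv_mem ha hb N h := N.ldiv_mem (ha N h) (hb N h)
  rdiv_mem ha hb N h := N.rdiv_mem (ha N h) (hb N h)
  innerT_mem x _ ha N h := N.innerT_mem x (ha N h)
  innerT_inv_mem x _ ha N h := N.innerT_inv_mem x (ha N h)
  innerL_mem x y _ ha N h := N.innerL_mem x y (ha N h)
  innerL_inv_mem x y _ ha N h := N.innerL_inv_mem x y (ha N h)
  innerR_mem x y _ ha N h := N.innerR_mem x y (ha N h)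
  innerR_inv_mem x y _ ha N h := N.innerR_inv_mem x y (ha N h)

/-- The normal subloop generated by a set. -/
def normalClosure (S : Set L) : NormalSubloop L := sInf {N | S ⊆ N.carrier}

theorem subset_normalClosure (S : Set L) : S ⊆ (normalClosure S).carrier :=
  fun _ hx _ hN => hN hx

theorem normalClosure_le {S : Set L} {N : NormalSubloop L} (h : S ⊆ N.carrier) {x : L}
    (hx : x ∈ normalClosure S) : x ∈ N := hx N h

/-- The whole loop as a normal subloop of itself. -/
def top (L : Type u) [AlgLoop L] : NormalSubloop L :=
  ofCongruence (fun _ _ => True) ⟨fun _ => trivial, fun _ => trivial, fun _ _ => trivial⟩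
    (fun _ _ => trivial) (fun _ _ => trivial) (fun _ _ => trivial)

theorem mem_top (x : L) : x ∈ top L := trivial

/-- The associator element `((xy)z) / (x(yz))`. -/
def assocElt (x y z : L) : L := rdiv ((x * y) * z) (x * (y * z))

theorem map_assocElt (f : L →* M) (x y z : L) :
    f (assocElt x y z) = assocElt (f x) (f y) (f z) := by
  simp [assocElt, map_rdiv]

/-- The set of associator elements with at least one entry in `K`. -/
def assocSet (K : NormalSubloop L) : Set L :=
  {a | ∃ k x y : L, k ∈ K ∧ (a = assocElt k x y ∨ a = assocElt x k y ∨ a = assocElt x y k)}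

/-- The associator `[K, L, L]` of a normal subloop `K` of `L`: the normal subloop of `L` generated
by the associator elements with at least one entry in `K`. -/
def associator (K : NormalSubloop L) : NormalSubloop L := normalClosure (assocSet K)

theorem map_mem_associator (f : L →* M) {K : NormalSubloop L} {K' : NormalSubloop M}
    (h : ∀ x ∈ K, f x ∈ K') {x : L} (hx : x ∈ associator K) : f x ∈ associator K' := by
  refine normalClosure_le (N := (associator K').comap f) ?_ hx
  rintro a ⟨k, x, y, hk, h1⟩
  apply subset_normalClosure
  refine ⟨f k, f x, f y, h k hk, ?_⟩
  rcases h1 with h1 | h1 | h1 <;> subst h1 <;> simp [map_assocElt]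

/-- A normal subloop is a loop. -/
instance (N : NormalSubloop L) : AlgLoop {x // x ∈ N} where
  mul a b := ⟨a.1 * b.1, N.mul_mem a.2 b.2⟩
  one := ⟨1, N.one_mem⟩
  one_mul a := Subtype.ext (one_mul a.1)
  mul_one a := Subtype.ext (mul_one a.1)
  ldiv a b := ⟨ldiv a.1 b.1, N.ldiv_mem a.2 b.2⟩
  rdiv a b := ⟨rdiv a.1 b.1, N.rdiv_mem a.2 b.2⟩
  mul_ldiv a b := Subtype.ext (mul_ldiv a.1 b.1)
  ldiv_mul a b := Subtype.ext (ldiv_mul a.1 b.1)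
  rdiv_mul a b := Subtype.ext (rdiv_mul a.1 b.1)
  mul_rdiv a b := Subtype.ext (mul_rdiv a.1 b.1)

/-- The inclusion of a normal subloop. -/
def subtype (N : NormalSubloop L) : {x // x ∈ N} →* L where
  toFun := Subtype.val
  map_one' := rfl
  map_mul' _ _ := rfl

/-! The quotient of a loop by a normal subloop. -/

/-- `x` and `y` are congruent modulo `N` when `y ∈ xN`. -/
def rel (N : NormalSubloop L) (x y : L) : Prop := ∃ n ∈ N, y = x * n

theorem comm_right (N : NormalSubloop L) (x : L) {n : L} (hn : n ∈ N) :
    ∃ m ∈ N, x * n = m * x := ⟨_, N.innerT_inv_mem x hn, by simp⟩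

theorem comm_left (N : NormalSubloop L) (x : L) {n : L} (hn : n ∈ N) :
    ∃ m ∈ N, n * x = x * m := ⟨_, N.innerT_mem x hn, by simp⟩

theorem assoc_right (N : NormalSubloop L) (x y : L) {n : L} (hn : n ∈ N) :
    ∃ m ∈ N, x * (y * n) = (x * y) * m := ⟨_, N.innerL_mem x y hn, by simp⟩

theorem assoc_right' (N : NormalSubloop L) (x y : L) {n : L} (hn : n ∈ N) :
    ∃ m ∈ N, (x * y) * n = x * (y * m) := ⟨_, N.innerL_inv_mem x y hn, by simp⟩

theorem assoc_left (N : NormalSubloop L) (x y : L) {n : L} (hn : n ∈ N) :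
    ∃ m ∈ N, (n * x) * y = m * (x * y) := ⟨_, N.innerR_mem x y hn, by simp⟩

theorem assoc_left' (N : NormalSubloop L) (x y : L) {n : L} (hn : n ∈ N) :
    ∃ m ∈ N, n * (x * y) = (m * x) * y := ⟨_, N.innerR_inv_mem x y hn, by simp⟩

theorem rel_equivalence (N : NormalSubloop L) : Equivalence N.rel where
  refl x := ⟨1, N.one_mem, by simp⟩
  symm := by
    rintro x y ⟨n, hn, rfl⟩
    obtain ⟨m, hm, e⟩ := N.assoc_right x n (N.ldiv_mem hn N.one_mem)
    exact ⟨m, hm, by simpa using e⟩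
  trans := by
    rintro x y z ⟨n, hn, rfl⟩ ⟨m, hm, rfl⟩
    obtain ⟨k, hk, e⟩ := N.assoc_right' x n hm
    exact ⟨n * k, N.mul_mem hn hk, e⟩

theorem rel_mul (N : NormalSubloop L) {a b c d : L} (h : N.rel a b) (h' : N.rel c d) :
    N.rel (a * c) (b * d) := by
  obtain ⟨n, hn, rfl⟩ := h
  obtain ⟨m, hm, rfl⟩ := h'
  obtain ⟨n1, hn1, e1⟩ := N.comm_right a hn
  obtain ⟨n2, hn2, e2⟩ := N.assoc_left a (c * m) hn1
  obtain ⟨m1, hm1, e3⟩ := N.assoc_right a c hm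
  obtain ⟨n3, hn3, e4⟩ := N.assoc_left' (a * c) m1 hn2
  obtain ⟨n4, hn4, e5⟩ := N.comm_left (a * c) hn3
  obtain ⟨m2, hm2, e6⟩ := N.assoc_right' (a * c) n4 hm1
  exact ⟨n4 * m2, N.mul_mem hn4 hm2, by rw [e1, e2, e3, e4, e5, e6]⟩

theorem rel_ldiv (N : NormalSubloop L) {a b c d : L} (h : N.rel a b) (h' : N.rel c d) :
    N.rel (ldiv a c) (ldiv b d) := by
  have h1 : N.rel (b * ldiv a c) (b * ldiv b d) := by
    have := N.rel_mul (N.rel_equivalence.symm h) (N.rel_equivalence.refl (ldiv a c))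
    rw [mul_ldiv] at this ⊢
    exact N.rel_equivalence.trans this h'
  obtain ⟨n, hn, e⟩ := h1
  obtain ⟨m, hm, e'⟩ := N.assoc_right' b (ldiv a c) hn
  exact ⟨m, hm, mul_left_cancel' (e.trans e')⟩

theorem rel_rdiv (N : NormalSubloop L) {a b c d : L} (h : N.rel a b) (h' : N.rel c d) :
    N.rel (rdiv a c) (rdiv b d) := by
  have h1 : N.rel (rdiv a c * d) (rdiv b d * d) := by
    have := N.rel_mul (N.rel_equivalence.refl (rdiv a c)) h'
    rw [rdiv_mul] at this ⊢
    exact N.rel_equivalence.trans (N.rel_equivalence.symm this) h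
  obtain ⟨n, hn, e⟩ := h1
  obtain ⟨n1, hn1, e1⟩ := N.comm_right (rdiv a c * d) hn
  obtain ⟨n2, hn2, e2⟩ := N.assoc_left' (rdiv a c) d hn1
  obtain ⟨n3, hn3, e3⟩ := N.comm_left (rdiv a c) hn2
  exact ⟨n3, hn3, (mul_right_cancel' (e.trans (e1.trans e2))).trans e3⟩

/-- Congruence modulo a normal subloop. -/
def setoid (N : NormalSubloop L) : Setoid L := ⟨N.rel, N.rel_equivalence⟩

/-- The quotient `L/N` of a loop by a normal subloop. -/
def Quot (N : NormalSubloop L) : Type u := Quotient N.setoid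

instance (N : NormalSubloop L) : AlgLoop N.Quot where
  mul := Quotient.map₂ (fun x y => x * y) (fun _ _ h _ _ h' => N.rel_mul h h')
  one := Quotient.mk _ 1
  one_mul := by rintro ⟨a⟩; exact congrArg (Quotient.mk N.setoid) (one_mul a)
  mul_one := by rintro ⟨a⟩; exact congrArg (Quotient.mk N.setoid) (mul_one a)
  ldiv := Quotient.map₂ ldiv (fun _ _ h _ _ h' => N.rel_ldiv h h')
  rdiv := Quotient.map₂ rdiv (fun _ _ h _ _ h' => N.rel_rdiv h h')
  mul_ldiv := by rintro ⟨a⟩ ⟨b⟩; exact congrArg (Quotient.mk N.setoid) (mul_ldiv a b)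
  ldiv_mul := by rintro ⟨a⟩ ⟨b⟩; exact congrArg (Quotient.mk N.setoid) (ldiv_mul a b)
  rdiv_mul := by rintro ⟨a⟩ ⟨b⟩; exact congrArg (Quotient.mk N.setoid) (rdiv_mul a b)
  mul_rdiv := by rintro ⟨a⟩ ⟨b⟩; exact congrArg (Quotient.mk N.setoid) (mul_rdiv a b)

/-- The quotient homomorphism `L → L/N`. -/
def toQuot (N : NormalSubloop L) : L →* N.Quot where
  toFun := Quotient.mk N.setoid
  map_one' := rfl
  map_mul' _ _ := rfl

theorem toQuot_surjective (N : NormalSubloop L) : Function.Surjective N.toQuot := Quotient.mk_surjective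

theorem toQuot_eq_toQuot (N : NormalSubloop L) {x y : L} : N.toQuot x = N.toQuot y ↔ ∃ n ∈ N, y = x * n :=
  Quotient.eq (r := N.setoid)

/-- A homomorphism that is trivial on `N` factors through `L/N`. -/
def lift (N : NormalSubloop L) (f : L →* M) (h : ∀ n ∈ N, f n = 1) : N.Quot →* M where
  toFun := Quotient.lift f (by rintro a b ⟨n, hn, rfl⟩; simp [h n hn])
  map_one' := map_one f
  map_mul' := by rintro ⟨a⟩ ⟨b⟩; exact map_mul f a b

@[simp] theorem lift_toQuot (N : NormalSubloop L) (f : L →* M) (h : ∀ n ∈ N, f n = 1) (x : L) :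
    N.lift f h (N.toQuot x) = f x := rfl

theorem toQuot_eq_one (N : NormalSubloop L) {n : L} (hn : n ∈ N) : N.toQuot n = 1 := by
  have : N.toQuot 1 = N.toQuot n := N.toQuot_eq_toQuot.2 ⟨n, hn, by simp⟩
  rw [← this, map_one]

/-- The homomorphism `L/N → M/N'` induced by a homomorphism `L → M` that maps `N` into `N'`. -/
def mapQuot (N : NormalSubloop L) (N' : NormalSubloop M) (f : L →* M)
    (h : ∀ n ∈ N, f n ∈ N') : N.Quot →* N'.Quot :=
  N.lift (N'.toQuot.comp f) (fun n hn => N'.toQuot_eq_one (h n hn))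

@[simp] theorem mapQuot_toQuot (N : NormalSubloop L) (N' : NormalSubloop M) (f : L →* M)
    (h : ∀ n ∈ N, f n ∈ N') (x : L) : N.mapQuot N' f h (N.toQuot x) = N'.toQuot (f x) := rfl

end

end NormalSubloop

/-! ### The category of loops -/

/-- The category of loops. -/
structure LoopCat : Type (u + 1) where
  /-- the underlying type -/
  carrier : Type u
  [str : AlgLoop carrier]

attribute [instance] LoopCat.str

namespace LoopCat

instance : CoeSort LoopCat (Type u) := ⟨LoopCat.carrier⟩

/-- Homomorphisms of loops. -/
@[ext]
structure Hom (A B : LoopCat.{u}) where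
  /-- the underlying homomorphism -/
  hom' : A →* B

instance : Category LoopCat.{u} where
  Hom A B := Hom A B
  id A := ⟨MonoidHom.id A⟩
  comp f g := ⟨g.hom'.comp f.hom'⟩

instance : ConcreteCategory LoopCat.{u} (· →* ·) where
  hom := Hom.hom'
  ofHom := Hom.mk

/-- The homomorphism underlying a morphism in `LoopCat`. -/
abbrev Hom.hom {A B : LoopCat.{u}} (f : A ⟶ B) : A →* B := ConcreteCategory.hom f

/-- The bundled loop on a type. -/
abbrev of (L : Type u) [AlgLoop L] : LoopCat := ⟨L⟩

/-- A homomorphism of loops as a morphism in `LoopCat`. -/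
abbrev ofHom {L M : Type u} [AlgLoop L] [AlgLoop M] (f : L →* M) : of L ⟶ of M :=
  ConcreteCategory.ofHom (C := LoopCat) f

/-- The loop underlying the pullback of two homomorphisms. -/
instance pullbackLoop {A B C : LoopCat.{u}} (f : A ⟶ C) (g : B ⟶ C) :
    AlgLoop {x : A × B // f x.1 = g x.2} where
  mul a b := ⟨(a.1.1 * b.1.1, a.1.2 * b.1.2), by simp [a.2, b.2]⟩
  one := ⟨(1, 1), by simp⟩
  one_mul a := Subtype.ext (Prod.ext (one_mul _) (one_mul _))
  mul_one a := Subtype.ext (Prod.ext (mul_one _) (mul_one _))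
  ldiv a b := ⟨(ldiv a.1.1 b.1.1, ldiv a.1.2 b.1.2), by
    have := map_ldiv f.hom a.1.1 b.1.1
    have h2 := map_ldiv g.hom a.1.2 b.1.2
    exact this.trans (by rw [h2, a.2, b.2])⟩
  rdiv a b := ⟨(rdiv a.1.1 b.1.1, rdiv a.1.2 b.1.2), by
    have := map_rdiv f.hom a.1.1 b.1.1
    have h2 := map_rdiv g.hom a.1.2 b.1.2
    exact this.trans (by rw [h2, a.2, b.2])⟩
  mul_ldiv a b := Subtype.ext (Prod.ext (mul_ldiv _ _) (mul_ldiv _ _))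
  ldiv_mul a b := Subtype.ext (Prod.ext (ldiv_mul _ _) (ldiv_mul _ _))
  rdiv_mul a b := Subtype.ext (Prod.ext (rdiv_mul _ _) (rdiv_mul _ _))
  mul_rdiv a b := Subtype.ext (Prod.ext (mul_rdiv _ _) (mul_rdiv _ _))

/-- The explicit pullback cone. -/
def pullbackCone {A B C : LoopCat.{u}} (f : A ⟶ C) (g : B ⟶ C) : PullbackCone f g :=
  PullbackCone.mk (W := of {x : A × B // f x.1 = g x.2})
    (ConcreteCategory.ofHom (C := LoopCat) (X := of {x : A × B // f x.1 = g x.2}) (Y := A)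
      { toFun := fun x => x.1.1, map_one' := rfl, map_mul' := fun _ _ => rfl })
    (ConcreteCategory.ofHom (C := LoopCat) (X := of {x : A × B // f x.1 = g x.2}) (Y := B)
      { toFun := fun x => x.1.2, map_one' := rfl, map_mul' := fun _ _ => rfl })
    (by ext x; exact x.2)

/-- The explicit pullback cone is a limit. -/
def pullbackConeIsLimit {A B C : LoopCat.{u}} (f : A ⟶ C) (g : B ⟶ C) :
    IsLimit (pullbackCone f g) :=
  PullbackCone.IsLimit.mk _
    (fun s => ConcreteCategory.ofHom (C := LoopCat) (X := s.pt)
      (Y := of {x : A × B // f x.1 = g x.2})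
      { toFun := fun x => ⟨(s.fst x, s.snd x), ConcreteCategory.congr_hom s.condition x⟩
        map_one' := Subtype.ext (Prod.ext (map_one s.fst.hom) (map_one s.snd.hom))
        map_mul' := fun x y =>
          Subtype.ext (Prod.ext (map_mul s.fst.hom x y) (map_mul s.snd.hom x y)) })
    (fun s => by ext x; rfl)
    (fun s => by ext x; rfl)
    (fun s m h1 h2 => by
      refine ConcreteCategory.hom_ext _ _ fun x => ?_
      exact Subtype.ext (Prod.ext (ConcreteCategory.congr_hom h1 x)
        (ConcreteCategory.congr_hom h2 x)))

instance : HasPullbacks LoopCat.{u} :=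
  have := fun {X Y Z : LoopCat.{u}} {f : X ⟶ Z} {g : Y ⟶ Z} =>
    (⟨⟨_, pullbackConeIsLimit f g⟩⟩ : HasLimit (cospan f g))
  hasPullbacks_of_hasLimit_cospan _

end LoopCat

/-! ### The reflection of loops into groups -/

/-- The inclusion `H` of groups into loops. -/
def grpToLoop : GrpCat.{u} ⥤ LoopCat.{u} where
  obj G := @LoopCat.of G (AlgLoop.ofGroup G)
  map {G G'} f := @LoopCat.ofHom G G' (AlgLoop.ofGroup G) (AlgLoop.ofGroup G') f.hom

/-- The loop `L/[L,L,L]` is a group. -/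
instance groupReflection (L : Type u) [AlgLoop L] :
    Group (NormalSubloop.associator (NormalSubloop.top L)).Quot where
  mul_assoc := by
    intro a b c
    obtain ⟨a, rfl⟩ := NormalSubloop.toQuot_surjective _ a
    obtain ⟨b, rfl⟩ := NormalSubloop.toQuot_surjective _ b
    obtain ⟨c, rfl⟩ := NormalSubloop.toQuot_surjective _ c
    have h : NormalSubloop.assocElt a b c ∈
        NormalSubloop.associator (NormalSubloop.top L) :=
      NormalSubloop.subset_normalClosure _
        ⟨a, b, c, NormalSubloop.mem_top a, Or.inl rfl⟩
    have h' := NormalSubloop.toQuot_eq_one _ h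
    rw [NormalSubloop.map_assocElt, NormalSubloop.assocElt] at h'
    rw [← rdiv_mul (_ * _ * _) (NormalSubloop.toQuot _ a * (NormalSubloop.toQuot _ b *
      NormalSubloop.toQuot _ c)), h', one_mul]
  one_mul := one_mul
  mul_one := mul_one
  inv a := rdiv 1 a
  inv_mul_cancel a := rdiv_mul 1 a

/-- The group reflection `I`, `I(L) = L/[L,L,L]`. -/
def loopToGrp : LoopCat.{u} ⥤ GrpCat.{u} where
  obj L := GrpCat.of (NormalSubloop.associator (NormalSubloop.top L)).Quot
  map {L M} f := GrpCat.ofHom (NormalSubloop.mapQuot _ _ f.hom (fun _ h =>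
    NormalSubloop.map_mem_associator f.hom (fun _ _ => NormalSubloop.mem_top _) h))
  map_id L := by
    ext x
    obtain ⟨x, rfl⟩ := NormalSubloop.toQuot_surjective _ x
    rfl
  map_comp f g := by
    ext x
    obtain ⟨x, rfl⟩ := NormalSubloop.toQuot_surjective _ x
    rfl

theorem map_associator_eq_one {L G : Type u} [AlgLoop L] [Group G] (f : L →* G) {x : L}
    (hx : x ∈ NormalSubloop.associator (NormalSubloop.top L)) : f x = 1 := by
  let _ := AlgLoop.ofGroup G
  have : x ∈ NormalSubloop.ker f := by
    refine NormalSubloop.normalClosure_le ?_ hx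
    rintro a ⟨k, y, z, -, h⟩
    have key : ∀ u v w : L, f (NormalSubloop.assocElt u v w) = f 1 := by
      intro u v w
      rw [NormalSubloop.map_assocElt, NormalSubloop.assocElt, mul_assoc, rdiv_self, map_one]
    rcases h with h | h | h <;> subst h <;> exact key _ _ _
  exact (show f x = f 1 from this).trans (map_one f)

/-- `I` is left adjoint to `H`. -/
def loopGrpAdj : loopToGrp.{u} ⊣ grpToLoop.{u} :=
  Adjunction.mkOfHomEquiv
    { homEquiv := fun L G =>
        { toFun := fun f => ConcreteCategory.ofHom (C := LoopCat) (X := L) (Y := grpToLoop.obj G)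
            (f.hom.comp (NormalSubloop.toQuot _))
          invFun := fun f => GrpCat.ofHom
            (letI := AlgLoop.ofGroup G
             NormalSubloop.lift _ (M := G) f.hom
              (fun _ h => map_associator_eq_one (G := G) f.hom h))
          left_inv := fun f => by
            ext x
            obtain ⟨x, rfl⟩ := NormalSubloop.toQuot_surjective _ x
            rfl
          right_inv := fun f => by ext x; rfl }
      homEquiv_naturality_left_symm := fun f g => by
        ext x
        obtain ⟨x, rfl⟩ := NormalSubloop.toQuot_surjective _ x
        rfl
      homEquiv_naturality_right := fun f g => by ext x; rfl }

/-! ### Connected components of simplicial groups -/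

/-- The normal subgroup of `G₀` generated by the elements `d₀(e) d₁(e)⁻¹`, `e ∈ G₁`. -/
def pi0Kernel (G : SimplicialObject GrpCat.{u}) : Subgroup (G _⦋0⦌) :=
  Subgroup.normalClosure {x | ∃ e : G _⦋1⦌, x = G.δ 0 e * (G.δ 1 e)⁻¹}

instance (G : SimplicialObject GrpCat.{u}) : (pi0Kernel G).Normal :=
  Subgroup.normalClosure_normal

theorem pi0Kernel_le_comap {G G' : SimplicialObject GrpCat.{u}} (f : G ⟶ G') :
    pi0Kernel G ≤ (pi0Kernel G').comap (f.app (op ⦋0⦌)).hom := by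
  refine Subgroup.normalClosure_le_normal ?_
  rintro x ⟨e, rfl⟩
  refine Subgroup.subset_normalClosure ⟨f.app (op ⦋1⦌) e, ?_⟩
  have h0 := ConcreteCategory.congr_hom (SimplicialObject.δ_naturality f (0 : Fin 2)) e
  have h1 := ConcreteCategory.congr_hom (SimplicialObject.δ_naturality f (1 : Fin 2)) e
  simp only [ConcreteCategory.comp_apply] at h0 h1
  rw [← h0, ← h1]
  simp

/-- The connected components functor `π₀` on simplicial groups: the coequaliser of
`d₀, d₁ : G₁ → G₀`. -/
def pi0Grp : SimplicialObject GrpCat.{u} ⥤ GrpCat.{u} where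
  obj G := GrpCat.of (G _⦋0⦌ ⧸ pi0Kernel G)
  map f := GrpCat.ofHom (QuotientGroup.map _ _ (f.app (op ⦋0⦌)).hom (pi0Kernel_le_comap f))
  map_id G := by
    refine ConcreteCategory.hom_ext _ _ fun x => ?_
    obtain ⟨x, rfl⟩ := QuotientGroup.mk_surjective x
    rfl
  map_comp f g := by
    refine ConcreteCategory.hom_ext _ _ fun x => ?_
    obtain ⟨x, rfl⟩ := QuotientGroup.mk_surjective x
    rfl

/-- The discrete simplicial group functor `D`. -/
abbrev discreteGrp : GrpCat.{u} ⥤ SimplicialObject GrpCat.{u} :=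
  Functor.const SimplexCategoryᵒᵖ

theorem pi0_vertex_eq (G : SimplicialObject GrpCat.{u}) {n : ℕ} (x : G _⦋n⦌)
    (i j : Fin (n + 1)) (h : i ≤ j) :
    (QuotientGroup.mk (G.map (SimplexCategory.const ⦋0⦌ ⦋n⦌ i).op x) : G _⦋0⦌ ⧸ pi0Kernel G) =
      QuotientGroup.mk (G.map (SimplexCategory.const ⦋0⦌ ⦋n⦌ j).op x) := by
  have e0 : SimplexCategory.δ (0 : Fin 2) ≫ SimplexCategory.mkOfLe i j h =
      SimplexCategory.const ⦋0⦌ ⦋n⦌ j := by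
    ext k; fin_cases k; rfl
  have e1 : SimplexCategory.δ (1 : Fin 2) ≫ SimplexCategory.mkOfLe i j h =
      SimplexCategory.const ⦋0⦌ ⦋n⦌ i := by
    ext k; fin_cases k; rfl
  have h0 : G.δ 0 (G.map (SimplexCategory.mkOfLe i j h).op x) =
      G.map (SimplexCategory.const ⦋0⦌ ⦋n⦌ j).op x := by
    rw [← e0, op_comp, G.map_comp]; rfl
  have h1 : G.δ 1 (G.map (SimplexCategory.mkOfLe i j h).op x) =
      G.map (SimplexCategory.const ⦋0⦌ ⦋n⦌ i).op x := by
    rw [← e1, op_comp, G.map_comp]; rfl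
  symm
  rw [← h0, ← h1, QuotientGroup.eq_iff_div_mem, div_eq_mul_inv]
  exact Subgroup.subset_normalClosure ⟨_, rfl⟩

/-- The unit `G → D(π₀(G))`: a simplex is sent to the component of its initial vertex. -/
def pi0Unit (G : SimplicialObject GrpCat.{u}) : G ⟶ discreteGrp.obj (pi0Grp.obj G) where
  app n := GrpCat.ofHom ((QuotientGroup.mk' (pi0Kernel G)).comp
    (G.map (SimplexCategory.const ⦋0⦌ n.unop 0).op).hom)
  naturality m n θ := by
    ext x
    have h := pi0_vertex_eq G (n := m.unop.len) x 0 (θ.unop.toOrderHom 0) (Fin.zero_le _)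
    have e : SimplexCategory.const ⦋0⦌ n.unop 0 ≫ θ.unop =
        SimplexCategory.const ⦋0⦌ m.unop (θ.unop.toOrderHom 0) := by
      ext k; rfl
    have h' : G.map (SimplexCategory.const ⦋0⦌ n.unop 0).op (G.map θ x) =
        G.map (SimplexCategory.const ⦋0⦌ m.unop (θ.unop.toOrderHom 0)).op x := by
      rw [← e, op_comp, G.map_comp]; rfl
    exact (congrArg QuotientGroup.mk h').trans h.symm

theorem pi0Kernel_le_ker {G : SimplicialObject GrpCat.{u}} {H : GrpCat.{u}}
    (f : G ⟶ discreteGrp.obj H) : pi0Kernel G ≤ (f.app (op ⦋0⦌)).hom.ker := by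
  refine Subgroup.normalClosure_le_normal ?_
  rintro x ⟨e, rfl⟩
  have h0 := ConcreteCategory.congr_hom (f.naturality (SimplexCategory.δ (0 : Fin 2)).op) e
  have h1 := ConcreteCategory.congr_hom (f.naturality (SimplexCategory.δ (1 : Fin 2)).op) e
  have h2 : (f.app (op ⦋0⦌)).hom (G.δ 0 e) = (f.app (op ⦋0⦌)).hom (G.δ 1 e) := h0.trans h1.symm
  change (f.app (op ⦋0⦌)).hom _ = 1
  rw [map_mul, map_inv, h2, mul_inv_cancel]

/-- `π₀` is left adjoint to `D`. -/
def pi0Adj : pi0Grp.{u} ⊣ discreteGrp.{u} :=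
  Adjunction.mkOfHomEquiv
    { homEquiv := fun G H =>
        { toFun := fun f => pi0Unit G ≫ discreteGrp.map f
          invFun := fun f => GrpCat.ofHom (QuotientGroup.lift _ (f.app (op ⦋0⦌)).hom
            (fun _ hx => pi0Kernel_le_ker f hx))
          left_inv := fun f => by
            refine ConcreteCategory.hom_ext _ _ fun x => ?_
            obtain ⟨x, rfl⟩ := QuotientGroup.mk_surjective x
            have e : SimplexCategory.const ⦋0⦌ ⦋0⦌ 0 = 𝟙 _ := by
              ext k; fin_cases k; rfl
            change f (QuotientGroup.mk (G.map (SimplexCategory.const ⦋0⦌ ⦋0⦌ 0).op x)) = _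
            rw [e, op_id, G.map_id]
            rfl
          right_inv := fun f => by
            ext n x
            exact ConcreteCategory.congr_hom
              (f.naturality (SimplexCategory.const ⦋0⦌ n.unop 0).op) x }
      homEquiv_naturality_left_symm := fun f g => by
        refine ConcreteCategory.hom_ext _ _ fun x => ?_
        obtain ⟨x, rfl⟩ := QuotientGroup.mk_surjective x
        rfl
      homEquiv_naturality_right := fun _ _ => rfl }

/-! ### The composite reflection -/

/-- The composite `π₀ ∘ S(I)` from simplicial loops to groups. -/
abbrev simplicialLoopReflector : SimplicialObject LoopCat.{u} ⥤ GrpCat.{u} :=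
  (SimplicialObject.whiskering _ _).obj loopToGrp ⋙ pi0Grp

/-- The inclusion `S(H) ∘ D` of groups in simplicial loops. -/
abbrev grpInclusion : GrpCat.{u} ⥤ SimplicialObject LoopCat.{u} :=
  discreteGrp ⋙ (SimplicialObject.whiskering _ _).obj grpToLoop

/-- The composite adjunction. -/
def reflectionAdj : simplicialLoopReflector.{u} ⊣ grpInclusion.{u} :=
  (loopGrpAdj.whiskerRight SimplexCategoryᵒᵖ).comp pi0Adj

/-! ### Normal extensions and the Galois group -/

section Galois

variable {𝒜 : Type*} [Category 𝒜] {ℬ : Type*} [Category ℬ]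

/-- Projectivity with respect to the class of regular epimorphisms. -/
def IsRegularProjective (P : 𝒜) : Prop :=
  ∀ ⦃X Y : 𝒜⦄ (e : X ⟶ Y) (f : P ⟶ Y), IsRegularEpi e → ∃ g : P ⟶ X, g ≫ e = f

/-- Trivial extensions with respect to a reflection `I ⊣ H`: regular epimorphisms whose naturality
square for the unit is a pullback. -/
structure IsTrivialExtension {I : 𝒜 ⥤ ℬ} {H : ℬ ⥤ 𝒜} (adj : I ⊣ H) {E B : 𝒜} (f : E ⟶ B) :
    Prop where
  isRegularEpi : IsRegularEpi f
  isPullback : IsPullback (adj.unit.app E) f (H.map (I.map f)) (adj.unit.app B)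

/-- Normal extensions: regular epimorphisms `p` whose pullback `p^*(p)` along itself is a trivial
extension. -/
structure IsNormalExtension [HasPullbacks 𝒜] {I : 𝒜 ⥤ ℬ} {H : ℬ ⥤ 𝒜} (adj : I ⊣ H) {E B : 𝒜}
    (p : E ⟶ B) : Prop where
  isRegularEpi : IsRegularEpi p
  isTrivial : IsTrivialExtension adj (pullback.fst p p)

/-- Weakly universal normal extensions of `B`. -/
structure IsWeaklyUniversalNormalExtension [HasPullbacks 𝒜] {I : 𝒜 ⥤ ℬ} {H : ℬ ⥤ 𝒜}
    (adj : I ⊣ H) {E B : 𝒜} (p : E ⟶ B) : Prop where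
  isNormal : IsNormalExtension adj p
  exists_hom : ∀ ⦃E' : 𝒜⦄ (p' : E' ⟶ B), IsNormalExtension adj p' → ∃ u : E ⟶ E', u ≫ p' = p

/-- The Galois group `Gal(E, p, 0)` with respect to a reflector `I` with values in groups: the
kernel of `⟨I(π₁), I(π₂)⟩ : I(E ×_B E) → I(E) × I(E)`. -/
noncomputable def galoisGroup [HasPullbacks 𝒜] (I : 𝒜 ⥤ GrpCat.{u}) {E B : 𝒜} (p : E ⟶ B) :
    GrpCat.{u} :=
  GrpCat.of (MonoidHom.ker
    ((I.map (pullback.fst p p)).hom.prod (I.map (pullback.snd p p)).hom))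

end Galois

/-! ### Normal subobjects of simplicial loops -/

/-- A normal subobject of a simplicial loop: a normal subloop in each degree, stable under the
simplicial operators. -/
@[ext]
structure NormalSub (A : SimplicialObject LoopCat.{u}) where
  /-- the degreewise normal subloops -/
  obj : ∀ n : SimplexCategoryᵒᵖ, NormalSubloop (A.obj n)
  map_mem : ∀ {m n : SimplexCategoryᵒᵖ} (θ : m ⟶ n) {x : A.obj m}, x ∈ obj m → A.map θ x ∈ obj n

namespace NormalSub

variable {A B : SimplicialObject LoopCat.{u}}

instance : LE (NormalSub A) := ⟨fun M N => ∀ n, ∀ x ∈ M.obj n, x ∈ N.obj n⟩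

/-- The intersection of a family of normal subobjects. -/
def sInf (S : Set (NormalSub A)) : NormalSub A where
  obj n := NormalSubloop.sInf {N | ∃ M ∈ S, N = M.obj n}
  map_mem θ x hx := by
    rintro _ ⟨M, hM, rfl⟩
    exact M.map_mem θ (hx _ ⟨M, hM, rfl⟩)

/-- The supremum `M ∨ N` of two normal subobjects: the smallest normal subobject that contains
both. -/
instance : Max (NormalSub A) := ⟨fun M N => sInf {T | M ≤ T ∧ N ≤ T}⟩

theorem le_sup_left (M N : NormalSub A) : M ≤ M ⊔ N := by
  rintro _ x hx _ ⟨T, hT, rfl⟩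
  exact hT.1 _ x hx

theorem le_sup_right (M N : NormalSub A) : N ≤ M ⊔ N := by
  rintro _ x hx _ ⟨T, hT, rfl⟩
  exact hT.2 _ x hx

theorem sup_le {M N T : NormalSub A} (h : M ≤ T) (h' : N ≤ T) : M ⊔ N ≤ T :=
  fun _ _ hx => hx _ ⟨T, ⟨h, h'⟩, rfl⟩

/-- `A` as a normal subobject of itself. -/
def top (A : SimplicialObject LoopCat.{u}) : NormalSub A where
  obj n := NormalSubloop.top (A.obj n)
  map_mem _ _ _ := NormalSubloop.mem_top _

/-- The inverse image of a normal subobject. -/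
def comap (f : A ⟶ B) (N : NormalSub B) : NormalSub A where
  obj n := (N.obj n).comap (f.app n).hom
  map_mem {m n} θ x hx := by
    have h := ConcreteCategory.congr_hom (f.naturality θ) x
    change f.app n (A.map θ x) ∈ N.obj n
    have h' : f.app n (A.map θ x) = B.map θ (f.app m x) := h
    rw [h']
    exact N.map_mem θ hx

/-- The kernel of a morphism of simplicial loops. -/
def ker (f : A ⟶ B) : NormalSub A where
  obj n := NormalSubloop.ker (f.app n).hom
  map_mem {m n} θ x hx := by
    have h : f.app n (A.map θ x) = B.map θ (f.app m x) :=
      ConcreteCategory.congr_hom (f.naturality θ) x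
    have hx' : f.app m x = f.app m 1 := hx
    change f.app n (A.map θ x) = f.app n 1
    rw [h, hx']
    simp

/-- A normal subobject as a simplicial loop. -/
def toSimplicial (N : NormalSub A) : SimplicialObject LoopCat.{u} where
  obj n := LoopCat.of {x // x ∈ N.obj n}
  map θ := LoopCat.ofHom
    { toFun := fun x => ⟨A.map θ x.1, N.map_mem θ x.2⟩
      map_one' := Subtype.ext (map_one (A.map θ).hom)
      map_mul' := fun x y => Subtype.ext (map_mul (A.map θ).hom x.1 y.1) }
  map_id n := by
    refine ConcreteCategory.hom_ext _ _ fun x => ?_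
    exact Subtype.ext (ConcreteCategory.congr_hom (A.map_id n) x.1)
  map_comp θ θ' := by
    refine ConcreteCategory.hom_ext _ _ fun x => ?_
    exact Subtype.ext (ConcreteCategory.congr_hom (A.map_comp θ θ') x.1)

/-- The inclusion of a normal subobject. -/
def ι (N : NormalSub A) : N.toSimplicial ⟶ A where
  app n := ConcreteCategory.ofHom (C := LoopCat) (X := LoopCat.of {x // x ∈ N.obj n})
    (Y := A.obj n) (N.obj n).subtype
  naturality _ _ _ := rfl

/-- The quotient `A/N` of a simplicial loop by a normal subobject. -/
def quotient (N : NormalSub A) : SimplicialObject LoopCat.{u} where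
  obj n := LoopCat.of (N.obj n).Quot
  map θ := LoopCat.ofHom
    (NormalSubloop.mapQuot _ _ (A.map θ).hom (fun _ h => N.map_mem θ h))
  map_id n := by
    ext x
    obtain ⟨x, rfl⟩ := NormalSubloop.toQuot_surjective _ x
    exact congrArg (N.obj n).toQuot (ConcreteCategory.congr_hom (A.map_id n) x)
  map_comp {_ _ n} θ θ' := by
    ext x
    obtain ⟨x, rfl⟩ := NormalSubloop.toQuot_surjective _ x
    exact congrArg (N.obj n).toQuot (ConcreteCategory.congr_hom (A.map_comp θ θ') x)

/-- The associator `[K, A, A]` of a normal subobject `K` of a simplicial loop `A`, defined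
degreewise. -/
def associator (K : NormalSub A) : NormalSub A where
  obj n := (K.obj n).associator
  map_mem θ _ hx := NormalSubloop.map_mem_associator (A.map θ).hom (fun _ h => K.map_mem θ h) hx

/-- Two vertices are joined by an edge. -/
def Joined (A : SimplicialObject LoopCat.{u}) (x y : A _⦋0⦌) : Prop :=
  ∃ e : A _⦋1⦌, A.δ 1 e = x ∧ A.δ 0 e = y

/-- Two vertices lie in the same connected component. -/
def SameComponent (A : SimplicialObject LoopCat.{u}) : A _⦋0⦌ → A _⦋0⦌ → Prop :=
  Relation.EqvGen (Joined A)

theorem sameComponent_equivalence (A : SimplicialObject LoopCat.{u}) :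
    Equivalence (SameComponent A) := Relation.EqvGen.is_equivalence _

theorem exists_degenerate (A : SimplicialObject LoopCat.{u}) (x : A _⦋0⦌) :
    ∃ s : A _⦋1⦌, A.δ 1 s = x ∧ A.δ 0 s = x :=
  ⟨A.σ 0 x, ConcreteCategory.congr_hom (A.δ_comp_σ_succ (i := (0 : Fin 1))) x,
    ConcreteCategory.congr_hom (A.δ_comp_σ_self (i := (0 : Fin 1))) x⟩

/-- An operation that commutes with the faces respects connected components. -/
theorem sameComponent_op (A : SimplicialObject LoopCat.{u}) (o₀ : A _⦋0⦌ → A _⦋0⦌ → A _⦋0⦌)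
    (o₁ : A _⦋1⦌ → A _⦋1⦌ → A _⦋1⦌)
    (h : ∀ (i : Fin 2) (a b : A _⦋1⦌), A.δ i (o₁ a b) = o₀ (A.δ i a) (A.δ i b))
    {a b c d : A _⦋0⦌} (hab : SameComponent A a b) (hcd : SameComponent A c d) :
    SameComponent A (o₀ a c) (o₀ b d) := by
  have h1 : SameComponent A (o₀ a c) (o₀ b c) := by
    obtain ⟨s, hs1, hs0⟩ := exists_degenerate A c
    induction hab with
    | rel x y hxy =>
      obtain ⟨e, rfl, rfl⟩ := hxy
      exact .rel _ _ ⟨o₁ e s, by rw [h, hs1], by rw [h, hs0]⟩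
    | refl x => exact .refl _
    | symm x y _ ih => exact .symm _ _ ih
    | trans x y z _ _ ih ih' => exact .trans _ _ _ ih ih'
  have h2 : SameComponent A (o₀ b c) (o₀ b d) := by
    obtain ⟨s, hs1, hs0⟩ := exists_degenerate A b
    clear h1
    induction hcd with
    | rel x y hxy =>
      obtain ⟨e, rfl, rfl⟩ := hxy
      exact .rel _ _ ⟨o₁ s e, by rw [h, hs1], by rw [h, hs0]⟩
    | refl x => exact .refl _
    | symm x y _ ih => exact .symm _ _ ih
    | trans x y z _ _ ih ih' => exact .trans _ _ _ ih ih'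
  exact .trans _ _ _ h1 h2

/-- The vertices in the connected component of `1`. -/
def componentVertices (A : SimplicialObject LoopCat.{u}) : NormalSubloop (A _⦋0⦌) :=
  NormalSubloop.ofCongruence (SameComponent A) (sameComponent_equivalence A)
    (fun h h' => sameComponent_op A (fun x y => x * y) (fun x y => x * y)
      (fun i a b => map_mul (A.δ i).hom a b) h h')
    (fun h h' => sameComponent_op A ldiv ldiv (fun i a b => map_ldiv (A.δ i).hom a b) h h')
    (fun h h' => sameComponent_op A rdiv rdiv (fun i a b => map_rdiv (A.δ i).hom a b) h h')

/-- The connected part `A₀` of a simplicial loop `A`: the connected component of `1`, consisting of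
all simplices whose vertices lie in the connected component of the vertex `1`. -/
def connectedPart (A : SimplicialObject LoopCat.{u}) : NormalSub A where
  obj n := NormalSubloop.sInf {N | ∃ v : n ⟶ op ⦋0⦌, N = (componentVertices A).comap (A.map v).hom}
  map_mem {m n} θ x hx := by
    rintro _ ⟨v, rfl⟩
    have h := hx _ ⟨θ ≫ v, rfl⟩
    have e : A.map v (A.map θ x) = A.map (θ ≫ v) x := by
      rw [A.map_comp]; rfl
    change A.map v (A.map θ x) ∈ componentVertices A
    rw [e]
    exact h

end NormalSub

/-! ### The two terms of the Hopf formula -/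

section Hopf

variable {P B : SimplicialObject LoopCat.{u}} (f : P ⟶ B)

/-- The kernel `K` of `f : P → B`, as a simplicial loop. -/
abbrev kernelObj : SimplicialObject LoopCat.{u} := (NormalSub.ker f).toSimplicial

/-- `K ∧ ([P,P,P] ∨ P₀)` as a normal subobject of `K`. -/
def hopfNumerator : NormalSub (kernelObj f) :=
  ((NormalSub.top P).associator ⊔ NormalSub.connectedPart P).comap (NormalSub.ker f).ι

/-- `[K,P,P] ∨ K₀` as a normal subobject of `K`. -/
def hopfDenominator : NormalSub (kernelObj f) :=
  (NormalSub.ker f).associator.comap (NormalSub.ker f).ι ⊔ NormalSub.connectedPart (kernelObj f)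

/-- The quotient `(K ∧ ([P,P,P] ∨ P₀)) / ([K,P,P] ∨ K₀)`. -/
def hopfQuotient : SimplicialObject LoopCat.{u} :=
  ((hopfDenominator f).comap (hopfNumerator f).ι).quotient

end Hopf

/-!
The kernel of the unit of the reflection at `A` is `[A,A,A] ∨ A₀`: dividing by the associators makes
`A` a simplicial group, and dividing further by the connected part leaves its discrete group of
components. A regular epimorphism `p : E ⟶ B` with kernel `K` is a normal extension if and only if
it is central, that is, if `[K,E,E]` and `K₀` are trivial. For the sufficiency one lets the kernel
pair of `p` act on `K` by `(x, y) • l = (y l) / x`. For a central `p` this is an action, and it is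
constant along edges, so the vertices of a pair `(1, y)` in the kernel of the unit act trivially. As
`(1, y)` sends `1` to `y`, the vertices of `y` are trivial, and so is `y` because `K` is discrete.

Dividing `P` by `[K,P,P] ∨ K₀`, where `K` is the kernel of `f : P ⟶ B`, is the universal way of
making `f` central, so it yields a weakly universal normal extension as soon as `f` lifts to every
normal extension of `B`. Two morphisms over `B` into a normal extension agree on the kernel of the
unit. Hence `Gal(E, p, 0)`, which `k ↦ (1, k)` identifies with the intersection of the kernel of `p`
and `[E,E,E] ∨ E₀`, is the same for all weakly universal normal extensions, and for the one
constructed from `f` it is the Hopf quotient.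
-/

/-! ### Loops -/

namespace AlgLoop

variable {L M : Type u} [AlgLoop L] [AlgLoop M]

theorem rdiv_eq_one_iff {x y : L} : rdiv x y = 1 ↔ x = y := by
  refine ⟨fun h => ?_, fun h => by rw [h, rdiv_self]⟩
  rw [← rdiv_mul x y, h, one_mul]

theorem map_rdiv_eq_one_iff (φ : L →* M) {x y : L} : φ (rdiv x y) = 1 ↔ φ x = φ y := by
  rw [map_rdiv, rdiv_eq_one_iff]

theorem injective_of_map_eq_one (φ : L →* M) (h : ∀ x, φ x = 1 → x = 1) : Function.Injective φ :=
  fun _ _ hxy => rdiv_eq_one_iff.1 (h _ ((map_rdiv_eq_one_iff φ).2 hxy))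

theorem map_rdiv_eq_div {G : Type u} [Group G] (φ : L →* G) (x y : L) :
    φ (rdiv x y) = φ x / φ y := by
  rw [eq_div_iff_mul_eq', ← map_mul, rdiv_mul]

/-- An associative loop is a group. -/
abbrev groupOfAssoc (h : ∀ x y z : L, x * y * z = x * (y * z)) : Group L where
  mul_assoc := h
  one_mul := one_mul
  mul_one := mul_one
  inv x := rdiv 1 x
  inv_mul_cancel x := rdiv_mul 1 x

/-- A reflexive relation on a loop that is a subloop of the square; such a relation is a congruence,
see `IsReflexiveCompatible.equivalence`. -/
structure IsReflexiveCompatible (r : L → L → Prop) : Prop where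
  refl : ∀ x, r x x
  mul : ∀ {a b c d}, r a b → r c d → r (a * c) (b * d)
  ldiv : ∀ {a b c d}, r a b → r c d → r (ldiv a c) (ldiv b d)
  rdiv : ∀ {a b c d}, r a b → r c d → r (rdiv a c) (rdiv b d)

namespace IsReflexiveCompatible

variable {r s : L → L → Prop}

-- Loops have the Maltsev term `(x / y) * z`.
theorem equivalence (hr : IsReflexiveCompatible r) : Equivalence r where
  refl := hr.refl
  symm {x y} h := by simpa using hr.mul (hr.rdiv (hr.refl x) h) (hr.refl y)
  trans {x y z} h h' := by simpa using hr.mul (hr.rdiv h (hr.refl y)) h'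

theorem comp (hr : IsReflexiveCompatible r) (hs : IsReflexiveCompatible s) :
    IsReflexiveCompatible (Relation.Comp r s) where
  refl x := ⟨x, hr.refl x, hs.refl x⟩
  mul := fun ⟨_, h₁, h₂⟩ ⟨_, k₁, k₂⟩ => ⟨_, hr.mul h₁ k₁, hs.mul h₂ k₂⟩
  ldiv := fun ⟨_, h₁, h₂⟩ ⟨_, k₁, k₂⟩ => ⟨_, hr.ldiv h₁ k₁, hs.ldiv h₂ k₂⟩
  rdiv := fun ⟨_, h₁, h₂⟩ ⟨_, k₁, k₂⟩ => ⟨_, hr.rdiv h₁ k₁, hs.rdiv h₂ k₂⟩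

/-- The class of `1` of the congruence `r`. -/
def normalSubloop (hr : IsReflexiveCompatible r) : NormalSubloop L :=
  .ofCongruence r hr.equivalence hr.mul hr.ldiv hr.rdiv

theorem mem_normalSubloop (hr : IsReflexiveCompatible r) {x : L} :
    x ∈ hr.normalSubloop ↔ r 1 x :=
  ⟨hr.equivalence.symm, hr.equivalence.symm⟩

end IsReflexiveCompatible

end AlgLoop

namespace NormalSubloop

variable {L M : Type u} [AlgLoop L] [AlgLoop M]

theorem mem_ker {φ : L →* M} {x : L} : x ∈ ker φ ↔ φ x = 1 := by
  rw [← map_one φ]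
  rfl

theorem assocElt_eq_one_iff {x y z : L} : assocElt x y z = 1 ↔ x * y * z = x * (y * z) :=
  rdiv_eq_one_iff

theorem toQuot_eq_one_iff (N : NormalSubloop L) {x : L} : N.toQuot x = 1 ↔ x ∈ N := by
  refine ⟨fun h => ?_, N.toQuot_eq_one⟩
  obtain ⟨n, hn, rfl⟩ := N.toQuot_eq_toQuot.1 ((map_one N.toQuot).trans h.symm)
  rwa [one_mul]

theorem isReflexiveCompatible_rel (N : NormalSubloop L) : IsReflexiveCompatible N.rel :=
  ⟨N.rel_equivalence.refl, N.rel_mul, N.rel_ldiv, N.rel_rdiv⟩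

/-- The product `MN` of two normal subloops. -/
def prod (M N : NormalSubloop L) : NormalSubloop L :=
  (M.isReflexiveCompatible_rel.comp N.isReflexiveCompatible_rel).normalSubloop

theorem mem_prod {M N : NormalSubloop L} {x : L} :
    x ∈ M.prod N ↔ ∃ m ∈ M, ∃ n ∈ N, x = m * n := by
  refine (IsReflexiveCompatible.mem_normalSubloop _).trans ⟨?_, ?_⟩
  · rintro ⟨_, ⟨m, hm, rfl⟩, n, hn, rfl⟩
    exact ⟨m, hm, n, hn, by rw [one_mul]⟩
  · rintro ⟨m, hm, n, hn, rfl⟩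
    exact ⟨m, ⟨m, hm, (one_mul m).symm⟩, n, hn, rfl⟩

end NormalSubloop

namespace LoopCat

instance : (forget LoopCat.{u}).ReflectsIsomorphisms where
  reflects {A B} f hf := by
    let e : A ≃* B := .ofBijective f.hom ((isIso_iff_bijective _).1 hf)
    exact ⟨ConcreteCategory.ofHom (C := LoopCat) (X := B) (Y := A) e.symm.toMonoidHom,
      by ext x; exact e.symm_apply_apply x, by ext x; exact e.apply_symm_apply x⟩

variable {A B C D : LoopCat.{u}}

instance (f : A ⟶ C) (g : B ⟶ C) : PreservesLimit (cospan f g) (forget LoopCat.{u}) :=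
  preservesLimit_of_preserves_limit_cone (pullbackConeIsLimit f g) <|
    (isLimitMapConePullbackConeEquiv _ _).symm <|
      (PullbackCone.isLimitEquivBijective _).symm Function.bijective_id

theorem isPullback_iff {a : A ⟶ B} {b : A ⟶ C} {c : B ⟶ D} {d : C ⟶ D} :
    IsPullback a b c d ↔ a ≫ c = b ≫ d ∧ (∀ x y : A, a x = a y ∧ b x = b y → x = y) ∧
      ∀ (x : B) (y : C), c x = d y → ∃ z : A, a z = x ∧ b z = y := by
  have := reflectsLimit_of_reflectsIsomorphisms (cospan c d) (forget LoopCat.{u})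
  rw [← and_iff_right_of_imp fun h : IsPullback a b c d => h.toCommSq.w]
  refine and_congr_right fun w => ?_
  rw [← IsPullback.map_iff (forget LoopCat.{u}) w, Types.isPullback_iff, ← Functor.map_comp, w,
    Functor.map_comp, eq_self_iff_true, true_and]
  rfl

end LoopCat

/-! ### Simplicial loops -/

namespace SimplicialLoop

variable {A B C : SimplicialObject LoopCat.{u}}

theorem app_app_of_comp_eq {f : A ⟶ B} {g : B ⟶ C} {h : A ⟶ C} (e : f ≫ g = h)
    {n : SimplexCategoryᵒᵖ} (x : A.obj n) : g.app n (f.app n x) = h.app n x :=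
  ConcreteCategory.congr_hom (NatTrans.congr_app e n) x

theorem isIso_of_bijective (f : A ⟶ B) (hf : ∀ n, Function.Bijective (f.app n)) : IsIso f := by
  have : ∀ n, IsIso (f.app n) := fun n =>
    (isIso_iff_of_reflects_iso _ (forget LoopCat)).1 ((isIso_iff_bijective _).2 (hf n))
  exact NatIso.isIso_of_isIso_app f

theorem epi_of_surjective {f : A ⟶ B} (hf : ∀ n, Function.Surjective (f.app n)) : Epi f := by
  refine ⟨fun g h e => ?_⟩
  ext n b
  obtain ⟨a, rfl⟩ := hf n b
  exact app_app_of_comp_eq e a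

theorem pullback_ext {p : A ⟶ C} {q : B ⟶ C} {n : SimplexCategoryᵒᵖ} {x y : (pullback p q).obj n}
    (h₁ : (pullback.fst p q).app n x = (pullback.fst p q).app n y)
    (h₂ : (pullback.snd p q).app n x = (pullback.snd p q).app n y) : x = y :=
  (LoopCat.isPullback_iff.1 ((IsPullback.of_hasPullback p q).app n)).2.1 x y ⟨h₁, h₂⟩

theorem exists_pullback {p : A ⟶ C} {q : B ⟶ C} {n : SimplexCategoryᵒᵖ} (x : A.obj n) (y : B.obj n)
    (h : p.app n x = q.app n y) :
    ∃ z : (pullback p q).obj n, (pullback.fst p q).app n z = x ∧ (pullback.snd p q).app n z = y :=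
  (LoopCat.isPullback_iff.1 ((IsPullback.of_hasPullback p q).app n)).2.2 x y h

end SimplicialLoop

namespace NormalSub

variable {A B C : SimplicialObject LoopCat.{u}}

theorem mem_ker {f : A ⟶ B} {n : SimplexCategoryᵒᵖ} {x : A.obj n} :
    x ∈ (ker f).obj n ↔ f.app n x = 1 :=
  NormalSubloop.mem_ker

theorem mem_sup {M N : NormalSub A} {n : SimplexCategoryᵒᵖ} {x : A.obj n} :
    x ∈ (M ⊔ N).obj n ↔ ∃ m ∈ M.obj n, ∃ k ∈ N.obj n, x = m * k := by
  constructor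
  · let T : NormalSub A :=
      { obj := fun n => (M.obj n).prod (N.obj n)
        map_mem := fun θ x hx => by
          obtain ⟨m, hm, k, hk, rfl⟩ := NormalSubloop.mem_prod.1 hx
          exact NormalSubloop.mem_prod.2
            ⟨_, M.map_mem θ hm, _, N.map_mem θ hk, map_mul (A.map θ).hom m k⟩ }
    have hT : M ⊔ N ≤ T := sup_le
      (fun n m hm => NormalSubloop.mem_prod.2 ⟨m, hm, 1, (N.obj n).one_mem, (mul_one m).symm⟩)
      (fun n k hk => NormalSubloop.mem_prod.2 ⟨1, (M.obj n).one_mem, k, hk, (one_mul k).symm⟩)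
    exact fun hx => NormalSubloop.mem_prod.1 (hT n x hx)
  · rintro ⟨m, hm, k, hk, rfl⟩
    exact ((M ⊔ N).obj n).mul_mem (le_sup_left M N n m hm) (le_sup_right M N n k hk)

/-- The morphism `M ⟶ N` of normal subobjects obtained by restricting `g`. -/
def restrict (g : A ⟶ B) (M : NormalSub A) (N : NormalSub B) (h : M ≤ N.comap g) :
    M.toSimplicial ⟶ N.toSimplicial where
  app n := LoopCat.ofHom
    { toFun := fun x => ⟨g.app n x.1, h n x.1 x.2⟩
      map_one' := Subtype.ext (map_one (g.app n).hom)
      map_mul' := fun x y => Subtype.ext (map_mul (g.app n).hom x.1 y.1) }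
  naturality _ _ θ := by
    ext x
    exact Subtype.ext (NatTrans.naturality_apply g θ x.1)

/-- The quotient morphism `A ⟶ A/N`. -/
def quotientMap (N : NormalSub A) : A ⟶ N.quotient where
  app n := ConcreteCategory.ofHom (C := LoopCat) (X := A.obj n) (Y := LoopCat.of (N.obj n).Quot)
    (N.obj n).toQuot

theorem quotientMap_surjective (N : NormalSub A) (n : SimplexCategoryᵒᵖ) :
    Function.Surjective (N.quotientMap.app n) :=
  (N.obj n).toQuot_surjective

theorem quotientMap_eq_one_iff (N : NormalSub A) {n : SimplexCategoryᵒᵖ} {x : A.obj n} :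
    N.quotientMap.app n x = 1 ↔ x ∈ N.obj n :=
  (N.obj n).toQuot_eq_one_iff

/-- The morphism `A/N ⟶ C` induced by a morphism that is trivial on `N`. -/
def desc (N : NormalSub A) (g : A ⟶ C) (h : N ≤ ker g) : N.quotient ⟶ C where
  app n := ConcreteCategory.ofHom (C := LoopCat) (X := LoopCat.of (N.obj n).Quot) (Y := C.obj n)
    ((N.obj n).lift (g.app n).hom fun x hx => mem_ker.1 (h n x hx))
  naturality m n θ := by
    ext x
    obtain ⟨x, rfl⟩ := N.quotientMap_surjective m x
    exact NatTrans.naturality_apply g θ x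

theorem quotientMap_desc (N : NormalSub A) (g : A ⟶ C) (h : N ≤ ker g) :
    N.quotientMap ≫ N.desc g h = g :=
  rfl

theorem isIso_desc (N : NormalSub A) {f : A ⟶ B} (hf : ∀ n, Function.Surjective (f.app n))
    (h : N ≤ ker f) (h' : ker f ≤ N) : IsIso (N.desc f h) := by
  refine SimplicialLoop.isIso_of_bijective _ fun n =>
    ⟨injective_of_map_eq_one ((N.desc f h).app n).hom fun x hx => ?_, fun b => ?_⟩
  · obtain ⟨a, rfl⟩ := N.quotientMap_surjective n x
    exact N.quotientMap_eq_one_iff.2 (h' n a (mem_ker.2 hx))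
  · obtain ⟨a, rfl⟩ := hf n b
    exact ⟨N.quotientMap.app n a, rfl⟩

end NormalSub

namespace SimplicialLoop

open NormalSub

variable {A B C : SimplicialObject LoopCat.{u}}

theorem exists_desc_of_surjective {f : A ⟶ B} (hf : ∀ n, Function.Surjective (f.app n)) {g : A ⟶ C}
    (h : ker f ≤ ker g) : ∃ d : B ⟶ C, f ≫ d = g := by
  let m := (ker f).desc f fun _ _ => id
  have : IsIso m := isIso_desc _ hf _ fun _ _ => id
  have hm : f ≫ inv m = (ker f).quotientMap := by rw [IsIso.comp_inv_eq, quotientMap_desc]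
  exact ⟨inv m ≫ (ker f).desc g h, by rw [← Category.assoc, hm, quotientMap_desc]⟩

theorem isRegularEpi_iff_surjective {f : A ⟶ B} :
    IsRegularEpi f ↔ ∀ n, Function.Surjective (f.app n) := by
  refine ⟨fun hf n b => ?_, fun hf => ?_⟩
  · let q := (ker f).quotientMap
    let m := (ker f).desc f fun _ _ => id
    have hq : IsRegularEpi.left f ≫ q = IsRegularEpi.right f ≫ q := by
      ext n x
      refine (map_rdiv_eq_one_iff (q.app n).hom).1 ((ker f).quotientMap_eq_one_iff.2 ?_)
      exact mem_ker.2 ((map_rdiv_eq_one_iff _).2 (app_app_of_comp_eq (IsRegularEpi.w f) x))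
    have hm : IsRegularEpi.desc f q hq ≫ m = 𝟙 B := by
      rw [← cancel_epi f, ← Category.assoc, IsRegularEpi.fac, quotientMap_desc, Category.comp_id]
    obtain ⟨a, ha⟩ := (ker f).quotientMap_surjective n ((IsRegularEpi.desc f q hq).app n b)
    refine ⟨a, ?_⟩
    calc f.app n a = m.app n (q.app n a) := rfl
      _ = m.app n ((IsRegularEpi.desc f q hq).app n b) := by rw [ha]
      _ = b := app_app_of_comp_eq hm b
  · have := epi_of_surjective hf
    refine IsRegularEpi.of_epi_of_exists fun C g hg => ?_
    refine exists_desc_of_surjective hf fun n x hx => mem_ker.2 ?_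
    obtain ⟨z, hz, rfl⟩ := exists_pullback (p := f) (q := f) 1 x
      ((map_one _).trans (mem_ker.1 hx).symm)
    exact (app_app_of_comp_eq hg.symm z).trans (by rw [NatTrans.comp_app_apply, hz, map_one])

end SimplicialLoop

/-! ### Connected components -/

namespace SimplicialLoop

open NormalSub

variable {A : SimplicialObject LoopCat.{u}} {n : SimplexCategoryᵒᵖ}

/-- The operator that sends an `n`-simplex to its initial vertex. -/
abbrev initialVertex (n : SimplexCategoryᵒᵖ) : n ⟶ op ⦋0⦌ :=
  (SimplexCategory.const ⦋0⦌ n.unop 0).op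

/-- The operator that sends a vertex to the totally degenerate `n`-simplex on it. -/
abbrev degenerate (n : SimplexCategoryᵒᵖ) : op ⦋0⦌ ⟶ n :=
  (SimplexCategory.const n.unop ⦋0⦌ 0).op

theorem map_vertex (θ : op ⦋0⦌ ⟶ op ⦋0⦌) (x : A _⦋0⦌) : A.map θ x = x := by
  obtain rfl : θ = 𝟙 _ := Quiver.Hom.unop_inj (SimplexCategory.isTerminalZero.hom_ext _ _)
  rw [A.map_id_apply]

theorem map_map_degenerate (v : n ⟶ op ⦋0⦌) (x : A _⦋0⦌) :
    A.map v (A.map (degenerate n) x) = x := by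
  rw [← A.map_comp_apply, map_vertex]

theorem joined_map_initialVertex (v : n ⟶ op ⦋0⦌) (x : A.obj n) :
    Joined A (A.map (initialVertex n) x) (A.map v x) := by
  let e : ⦋1⦌ ⟶ ⦋n.unop.len⦌ := SimplexCategory.mkOfLe 0 (v.unop.toOrderHom 0) (Fin.zero_le _)
  have h₁ : SimplexCategory.δ 1 ≫ e = SimplexCategory.const ⦋0⦌ n.unop 0 := by
    ext k; fin_cases k; rfl
  have h₀ : SimplexCategory.δ 0 ≫ e = v.unop := by
    ext k; fin_cases k; rfl
  refine ⟨A.map e.op x, ?_, ?_⟩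
  · rw [SimplicialObject.δ, ← A.map_comp_apply, ← op_comp, h₁]
  · rw [SimplicialObject.δ, ← A.map_comp_apply, ← op_comp, h₀, Quiver.Hom.op_unop]

theorem isReflexiveCompatible_joined : IsReflexiveCompatible (Joined A) where
  refl := exists_degenerate A
  mul := by
    rintro _ _ _ _ ⟨e, rfl, rfl⟩ ⟨e', rfl, rfl⟩
    exact ⟨e * e', map_mul _ _ _, map_mul _ _ _⟩
  ldiv := by
    rintro _ _ _ _ ⟨e, rfl, rfl⟩ ⟨e', rfl, rfl⟩
    exact ⟨ldiv e e', map_ldiv _ _ _, map_ldiv _ _ _⟩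
  rdiv := by
    rintro _ _ _ _ ⟨e, rfl, rfl⟩ ⟨e', rfl, rfl⟩
    exact ⟨rdiv e e', map_rdiv _ _ _, map_rdiv _ _ _⟩

theorem mem_componentVertices {x : A _⦋0⦌} : x ∈ componentVertices A ↔ Joined A 1 x := by
  have hA := isReflexiveCompatible_joined (A := A)
  exact hA.equivalence.eqvGen_iff.trans ⟨hA.equivalence.symm, hA.equivalence.symm⟩

/-- The normal subobject of the simplices all of whose vertices lie in `V`. -/
def verticesIn (V : NormalSubloop (A _⦋0⦌)) : NormalSub A where
  obj n := NormalSubloop.sInf {N | ∃ v : n ⟶ op ⦋0⦌, N = V.comap (A.map v).hom}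
  map_mem θ x hx := by
    rintro _ ⟨v, rfl⟩
    change A.map v (A.map θ x) ∈ V
    rw [← A.map_comp_apply]
    exact hx _ ⟨θ ≫ v, rfl⟩

theorem mem_verticesIn {V : NormalSubloop (A _⦋0⦌)} {x : A.obj n} :
    x ∈ (verticesIn V).obj n ↔ ∀ v : n ⟶ op ⦋0⦌, A.map v x ∈ V :=
  ⟨fun h v => h _ ⟨v, rfl⟩, by rintro h _ ⟨v, rfl⟩; exact h v⟩

theorem mem_connectedPart {x : A.obj n} :
    x ∈ (connectedPart A).obj n ↔ ∀ v : n ⟶ op ⦋0⦌, A.map v x ∈ componentVertices A :=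
  mem_verticesIn

theorem mem_connectedPart_iff_initialVertex {x : A.obj n} :
    x ∈ (connectedPart A).obj n ↔ A.map (initialVertex n) x ∈ componentVertices A := by
  refine mem_connectedPart.trans ⟨fun h => h _, fun h v => mem_componentVertices.2 ?_⟩
  exact isReflexiveCompatible_joined.equivalence.trans (mem_componentVertices.1 h)
    (joined_map_initialVertex v x)

theorem mem_iff_initialVertex_mem {N : NormalSub A} (hN : connectedPart A ≤ N) {x : A.obj n} :
    x ∈ N.obj n ↔ A.map (initialVertex n) x ∈ N.obj (op ⦋0⦌) := by
  refine ⟨fun hx => N.map_mem _ hx, fun hx => ?_⟩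
  let s := A.map (degenerate n) (A.map (initialVertex n) x)
  have h : rdiv x s ∈ N.obj n := hN _ _ <| mem_connectedPart_iff_initialVertex.2 <| by
    rw [map_rdiv, map_map_degenerate, rdiv_self]
    exact NormalSubloop.one_mem _
  rw [← rdiv_mul x s]
  exact (N.obj n).mul_mem h (N.map_mem _ hx)

end SimplicialLoop

/-! ### The unit of the reflection -/

namespace SimplicialLoop

open NormalSub

variable {A B : SimplicialObject LoopCat.{u}} {n : SimplexCategoryᵒᵖ}

/-- The unit of the reflection in degree `n`, with values in the reflected group. -/
def unitHom (A : SimplicialObject LoopCat.{u}) (n : SimplexCategoryᵒᵖ) :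
    A.obj n →* simplicialLoopReflector.obj A :=
  ((reflectionAdj.unit.app A).app n).hom

theorem unitHom_map {m : SimplexCategoryᵒᵖ} (θ : m ⟶ n) (x : A.obj m) :
    unitHom A n (A.map θ x) = unitHom A m x :=
  NatTrans.naturality_apply (reflectionAdj.unit.app A) θ x

theorem unitHom_app (f : A ⟶ B) (x : A.obj n) :
    unitHom B n (f.app n x) = simplicialLoopReflector.map f (unitHom A n x) :=
  app_app_of_comp_eq (reflectionAdj.unit.naturality f) x

theorem unitHom_app_eq_one (f : A ⟶ B) {x : A.obj n} (hx : unitHom A n x = 1) :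
    unitHom B n (f.app n x) = 1 := by
  rw [unitHom_app, hx, map_one]

theorem unitHom_surjective (A : SimplicialObject LoopCat.{u}) (n : SimplexCategoryᵒᵖ) :
    Function.Surjective (unitHom A n) := by
  intro g
  obtain ⟨y, rfl⟩ := QuotientGroup.mk_surjective g
  obtain ⟨x, rfl⟩ := NormalSubloop.toQuot_surjective _ y
  refine ⟨A.map (degenerate n) x, (unitHom_map (degenerate n) x).trans ?_⟩
  exact congrArg (fun t => QuotientGroup.mk (NormalSubloop.toQuot _ t)) (map_vertex _ x)

theorem unitHom_eq_of_joined {x y : A _⦋0⦌} (h : Joined A x y) :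
    unitHom A (op ⦋0⦌) x = unitHom A (op ⦋0⦌) y := by
  obtain ⟨e, rfl, rfl⟩ := h
  exact (unitHom_map _ e).trans (unitHom_map _ e).symm

theorem app_eq_one_of_unitHom_eq_one {G : GrpCat.{u}} (g : A ⟶ grpInclusion.obj G) {x : A.obj n}
    (hx : unitHom A n x = 1) : g.app n x = 1 := by
  let h := (reflectionAdj.homEquiv A G).symm g
  have hg : reflectionAdj.unit.app A ≫ grpInclusion.map h = g :=
    (reflectionAdj.homEquiv_unit A G h).symm.trans (Equiv.apply_symm_apply _ g)
  exact (app_app_of_comp_eq hg x).symm.trans ((congrArg h hx).trans (map_one h.hom))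

/-- The morphism into a discrete simplicial group given by a homomorphism on the vertices. -/
def toDiscrete {G : GrpCat.{u}} (φ : A _⦋0⦌ →* G) (hφ : ∀ x y, Joined A x y → φ x = φ y) :
    A ⟶ grpInclusion.obj G where
  app n := ConcreteCategory.ofHom (C := LoopCat) (X := A.obj n) (Y := grpToLoop.obj G)
    (φ.comp (A.map (initialVertex n)).hom)
  naturality m n θ := by
    ext x
    change φ (A.map (initialVertex n) (A.map θ x)) = φ (A.map (initialVertex m) x)
    rw [← A.map_comp_apply]
    exact (hφ _ _ (joined_map_initialVertex _ x)).symm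

theorem map_initialVertex_eq_one_of_unitHom_eq_one {G : Type u} [Group G] (φ : A _⦋0⦌ →* G)
    (hφ : ∀ x y, Joined A x y → φ x = φ y) {x : A.obj n} (hx : unitHom A n x = 1) :
    φ (A.map (initialVertex n) x) = 1 :=
  app_eq_one_of_unitHom_eq_one (toDiscrete (G := GrpCat.of G) φ hφ) hx

theorem associator_sup_connectedPart_le_ker_unit :
    (top A).associator ⊔ connectedPart A ≤ ker (reflectionAdj.unit.app A) := by
  refine NormalSub.sup_le (fun n x hx => mem_ker.2 ?_) (fun n x hx => mem_ker.2 ?_)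
  · exact map_associator_eq_one (unitHom A n) hx
  · have h := mem_componentVertices.1 (mem_connectedPart_iff_initialVertex.1 hx)
    exact (unitHom_map (initialVertex n) x).symm.trans
      ((unitHom_eq_of_joined h).symm.trans (map_one _))

theorem mem_associator_sup_connectedPart {x : A.obj n} :
    x ∈ ((top A).associator ⊔ connectedPart A).obj n ↔ unitHom A n x = 1 := by
  refine ⟨fun hx => mem_ker.1 (associator_sup_connectedPart_le_ker_unit n x hx), fun hx => ?_⟩
  rw [mem_iff_initialVertex_mem (NormalSub.le_sup_right _ _)]
  let N := ((top A).associator ⊔ connectedPart A).obj (op ⦋0⦌)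
  have hN : ∀ a b c : N.Quot, a * b * c = a * (b * c) := by
    intro a b c
    obtain ⟨a, rfl⟩ := N.toQuot_surjective a
    obtain ⟨b, rfl⟩ := N.toQuot_surjective b
    obtain ⟨c, rfl⟩ := N.toQuot_surjective c
    rw [← NormalSubloop.assocElt_eq_one_iff, ← NormalSubloop.map_assocElt, N.toQuot_eq_one_iff]
    exact NormalSub.le_sup_left _ _ _ _ <| NormalSubloop.subset_normalClosure _
      ⟨a, b, c, NormalSubloop.mem_top a, Or.inl rfl⟩
  let _ : Group N.Quot := groupOfAssoc hN
  rw [← N.toQuot_eq_one_iff]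
  refine map_initialVertex_eq_one_of_unitHom_eq_one (G := N.Quot) N.toQuot ?_ hx
  intro x y hxy
  rw [← map_rdiv_eq_one_iff, N.toQuot_eq_one_iff]
  refine NormalSub.le_sup_right _ _ _ _ (mem_connectedPart_iff_initialVertex.2 ?_)
  rw [map_vertex, mem_componentVertices]
  rw [← rdiv_self x]
  exact isReflexiveCompatible_joined.rdiv (exists_degenerate A x) hxy

end SimplicialLoop

/-! ### Normal extensions and central extensions -/

namespace SimplicialLoop

open NormalSub

variable {A B E : SimplicialObject LoopCat.{u}} {n : SimplexCategoryᵒᵖ}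

theorem eq_of_isTrivialExtension {f : A ⟶ B} (hf : IsTrivialExtension reflectionAdj f)
    {x y : A.obj n} (h : f.app n x = f.app n y) (h' : unitHom A n x = unitHom A n y) : x = y :=
  (LoopCat.isPullback_iff.1 (hf.isPullback.app n)).2.1 x y ⟨h', h⟩

theorem isTrivialExtension_of_comp_eq_id {f : A ⟶ B} {s : B ⟶ A} (hs : s ≫ f = 𝟙 B)
    (hf : ∀ n (x : A.obj n), f.app n x = 1 → unitHom A n x = 1 → x = 1) :
    IsTrivialExtension reflectionAdj f := by
  have hfs {n} (y : B.obj n) : f.app n (s.app n y) = y := app_app_of_comp_eq hs y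
  refine ⟨isRegularEpi_iff_surjective.2 fun n y => ⟨_, hfs y⟩, ?_⟩
  refine IsPullback.of_forall_isPullback_app fun n => LoopCat.isPullback_iff.2 ⟨?_, ?_, ?_⟩
  · exact (NatTrans.congr_app (reflectionAdj.unit.naturality f) n).symm
  · rintro x y ⟨h', h⟩
    exact rdiv_eq_one_iff.1 (hf n _ ((map_rdiv_eq_one_iff _).2 h)
      ((map_rdiv_eq_div _ _ _).trans (div_eq_one.2 h')))
  · intro g y hgy
    obtain ⟨w, rfl⟩ := unitHom_surjective A n g
    have hw : unitHom B n (rdiv y (f.app n w)) = 1 := by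
      rw [map_rdiv_eq_div, div_eq_one, unitHom_app]
      exact hgy.symm
    refine ⟨s.app n (rdiv y (f.app n w)) * w, ?_, ?_⟩
    · refine (map_mul (unitHom A n) _ _).trans ?_
      rw [unitHom_app_eq_one s hw, one_mul]
    · rw [map_mul, hfs, rdiv_mul]

theorem app_fst_eq_app_snd {p : E ⟶ B} (z : (pullback p p).obj n) :
    p.app n ((pullback.fst p p).app n z) = p.app n ((pullback.snd p p).app n z) :=
  ConcreteCategory.congr_hom (NatTrans.congr_app (pullback.condition (f := p) (g := p)) n) z

theorem app_rdiv_snd_mul_fst {p : E ⟶ B} (z : (pullback p p).obj n) {l : E.obj n}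
    (hl : p.app n l = 1) :
    p.app n (rdiv ((pullback.snd p p).app n z * l) ((pullback.fst p p).app n z)) = 1 := by
  rw [map_rdiv, map_mul, hl, mul_one, app_fst_eq_app_snd, rdiv_self]

theorem app_eq_of_unitHom_eq_one {p : E ⟶ B} (hp : IsNormalExtension reflectionAdj p)
    {u v : A ⟶ E} (h : u ≫ p = v ≫ p) {x : A.obj n} (hx : unitHom A n x = 1) :
    u.app n x = v.app n x := by
  let uu : A ⟶ pullback p p := pullback.lift u u rfl
  let uv : A ⟶ pullback p p := pullback.lift u v h
  have huv : uu.app n x = uv.app n x := by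
    refine eq_of_isTrivialExtension hp.isTrivial ?_ ?_
    · exact (app_app_of_comp_eq (pullback.lift_fst _ _ _) x).trans
        (app_app_of_comp_eq (pullback.lift_fst _ _ _) x).symm
    · rw [unitHom_app_eq_one uu hx, unitHom_app_eq_one uv hx]
  calc u.app n x = (pullback.snd p p).app n (uu.app n x) :=
        (app_app_of_comp_eq (pullback.lift_snd _ _ _) x).symm
    _ = (pullback.snd p p).app n (uv.app n x) := by rw [huv]
    _ = v.app n x := app_app_of_comp_eq (pullback.lift_snd _ _ _) x

/-- A morphism is central when all associators with an entry in its kernel are trivial and its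
kernel is discrete, in the sense that a simplex of the kernel is determined by its initial
vertex. -/
structure IsCentral (p : E ⟶ B) : Prop where
  assoc : ∀ n, ∀ a ∈ NormalSubloop.assocSet ((ker p).obj n), a = 1
  discrete : ∀ n (k : E.obj n), p.app n k = 1 → E.map (initialVertex n) k = 1 → k = 1

namespace IsCentral

variable {p : E ⟶ B}

theorem δ_eq (hp : IsCentral p) {e : E _⦋1⦌} (he : p.app _ e = 1) : E.δ 0 e = E.δ 1 e := by
  let s := E.map (degenerate (op ⦋1⦌)) (E.map (initialVertex (op ⦋1⦌)) e)
  have hes : e = s := by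
    refine rdiv_eq_one_iff.1 (hp.discrete _ _ ?_ ?_)
    · rw [map_rdiv, NatTrans.naturality_apply, NatTrans.naturality_apply, he, map_one, map_one,
        rdiv_self]
    · rw [map_rdiv, map_map_degenerate, rdiv_self]
  rw [hes, SimplicialObject.δ, SimplicialObject.δ, map_map_degenerate, map_map_degenerate]

theorem mul_assoc_left (hp : IsCentral p) {k : E.obj n} (hk : p.app n k = 1) (x y : E.obj n) :
    k * x * y = k * (x * y) :=
  NormalSubloop.assocElt_eq_one_iff.1 (hp.assoc n _ ⟨k, x, y, mem_ker.2 hk, .inl rfl⟩)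

theorem mul_assoc_middle (hp : IsCentral p) {k : E.obj n} (hk : p.app n k = 1) (x y : E.obj n) :
    x * k * y = x * (k * y) :=
  NormalSubloop.assocElt_eq_one_iff.1 (hp.assoc n _ ⟨k, x, y, mem_ker.2 hk, .inr (.inl rfl)⟩)

theorem mul_assoc_right (hp : IsCentral p) {k : E.obj n} (hk : p.app n k = 1) (x y : E.obj n) :
    x * y * k = x * (y * k) :=
  NormalSubloop.assocElt_eq_one_iff.1 (hp.assoc n _ ⟨k, x, y, mem_ker.2 hk, .inr (.inr rfl)⟩)

/-- The kernel pair of a central morphism acts on its kernel by `(x, y) • l = (y * l) / x`. -/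
noncomputable def kernelAction (hp : IsCentral p) (n : SimplexCategoryᵒᵖ) :
    (pullback p p).obj n →* Equiv.Perm {l : E.obj n // p.app n l = 1} where
  toFun z :=
    { toFun := fun l => ⟨_, app_rdiv_snd_mul_fst z l.2⟩
      invFun := fun l => ⟨ldiv ((pullback.snd p p).app n z) (l * (pullback.fst p p).app n z), by
        rw [map_ldiv, map_mul, l.2, one_mul, app_fst_eq_app_snd, ldiv_self]⟩
      left_inv := fun l => Subtype.ext (by simp)
      right_inv := fun l => Subtype.ext (by simp) }
  map_one' := Equiv.ext fun l => Subtype.ext <| by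
    change rdiv ((pullback.snd p p).app n 1 * l.1) ((pullback.fst p p).app n 1) = l.1
    rw [map_one, map_one, one_mul]
    simpa only [mul_one] using mul_rdiv l.1 1
  map_mul' z w := Equiv.ext fun ⟨l, hl⟩ => Subtype.ext <| by
    let x := (pullback.fst p p).app n z
    let y := (pullback.snd p p).app n z
    let x' := (pullback.fst p p).app n w
    let y' := (pullback.snd p p).app n w
    let k := rdiv (y' * l) x'
    have hk : p.app n k = 1 := app_rdiv_snd_mul_fst w hl
    have h : rdiv (y * y' * l) (x * x') = rdiv (y * k) x := by
      refine mul_right_cancel' (z := x * x') ?_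
      calc rdiv (y * y' * l) (x * x') * (x * x') = y * y' * l := rdiv_mul _ _
        _ = y * (y' * l) := hp.mul_assoc_right hl y y'
        _ = y * (k * x') := by rw [rdiv_mul]
        _ = y * k * x' := (hp.mul_assoc_middle hk y x').symm
        _ = rdiv (y * k) x * x * x' := by rw [rdiv_mul]
        _ = rdiv (y * k) x * (x * x') := hp.mul_assoc_left (app_rdiv_snd_mul_fst z hk) x x'
    refine Eq.trans ?_ h
    exact congrArg₂ (fun a b => rdiv (a * l) b) (map_mul _ z w) (map_mul _ z w)

theorem kernelAction_apply (hp : IsCentral p) (z : (pullback p p).obj n)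
    (l : {l : E.obj n // p.app n l = 1}) :
    (hp.kernelAction n z l).1 =
      rdiv ((pullback.snd p p).app n z * l.1) ((pullback.fst p p).app n z) :=
  rfl

theorem kernelAction_eq_of_joined (hp : IsCentral p) {x y : (pullback p p) _⦋0⦌}
    (h : Joined (pullback p p) x y) :
    hp.kernelAction (op ⦋0⦌) x = hp.kernelAction (op ⦋0⦌) y := by
  obtain ⟨e, rfl, rfl⟩ := h
  refine Equiv.ext fun l => Subtype.ext ?_
  let s := E.map (degenerate (op ⦋1⦌)) l.1
  have hs : p.app _ s = 1 := by rw [NatTrans.naturality_apply, l.2, map_one]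
  have hδ (i : Fin 2) : (hp.kernelAction _ ((pullback p p).δ i e) l).1 =
      E.δ i (rdiv ((pullback.snd p p).app _ e * s) ((pullback.fst p p).app _ e)) := by
    rw [map_rdiv, map_mul, kernelAction_apply]
    simp only [s, SimplicialObject.δ, NatTrans.naturality_apply, map_map_degenerate]
  rw [hδ, hδ, hp.δ_eq (app_rdiv_snd_mul_fst e hs)]

theorem isNormalExtension (hp : IsCentral p) (hp' : ∀ n, Function.Surjective (p.app n)) :
    IsNormalExtension reflectionAdj p := by
  refine ⟨isRegularEpi_iff_surjective.2 hp', ?_⟩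
  refine isTrivialExtension_of_comp_eq_id (pullback.diagonal_fst p) fun n z hz₁ hz => ?_
  have hz₂ : p.app n ((pullback.snd p p).app n z) = 1 := by
    rw [← app_fst_eq_app_snd, hz₁, map_one]
  have hact := map_initialVertex_eq_one_of_unitHom_eq_one (hp.kernelAction (op ⦋0⦌))
    (fun _ _ => hp.kernelAction_eq_of_joined) hz
  have hv := congrArg Subtype.val (Equiv.congr_fun hact ⟨1, map_one (p.app _).hom⟩)
  rw [kernelAction_apply, NatTrans.naturality_apply, NatTrans.naturality_apply, hz₁, map_one,
    mul_one, Equiv.Perm.one_apply, rdiv_eq_one_iff] at hv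
  exact pullback_ext (hz₁.trans (map_one _).symm)
    ((hp.discrete n _ hz₂ hv).trans (map_one _).symm)

end IsCentral

theorem unitHom_assocElt_eq_one (x y z : A.obj n) :
    unitHom A n (NormalSubloop.assocElt x y z) = 1 :=
  map_associator_eq_one (unitHom A n) <| NormalSubloop.subset_normalClosure _
    ⟨x, y, z, NormalSubloop.mem_top x, .inl rfl⟩

theorem eq_one_of_isNormalExtension {p : E ⟶ B} (hp : IsNormalExtension reflectionAdj p)
    {z : (pullback p p).obj n} (hz₁ : (pullback.fst p p).app n z = 1)
    (hz : unitHom (pullback p p) n z = 1) : z = 1 :=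
  eq_of_isTrivialExtension hp.isTrivial (hz₁.trans (map_one _).symm) (hz.trans (map_one _).symm)

theorem assocElt_eq_one_of_app_eq {p : E ⟶ B} (hp : IsNormalExtension reflectionAdj p)
    {x y z x' y' z' : E.obj n} (hx : p.app n x = p.app n x') (hy : p.app n y = p.app n y')
    (hz : p.app n z = p.app n z') (h : NormalSubloop.assocElt x y z = 1) :
    NormalSubloop.assocElt x' y' z' = 1 := by
  obtain ⟨a, rfl, rfl⟩ := exists_pullback x x' hx
  obtain ⟨b, rfl, rfl⟩ := exists_pullback y y' hy
  obtain ⟨c, rfl, rfl⟩ := exists_pullback z z' hz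
  have habc : NormalSubloop.assocElt a b c = 1 :=
    eq_one_of_isNormalExtension hp ((NormalSubloop.map_assocElt _ a b c).trans h)
      (unitHom_assocElt_eq_one a b c)
  rw [← NormalSubloop.map_assocElt, habc, map_one]

theorem isCentral_of_isNormalExtension {p : E ⟶ B} (hp : IsNormalExtension reflectionAdj p) :
    IsCentral p where
  assoc := by
    rintro n _ ⟨k, x, y, hk, h⟩
    have hk : p.app n 1 = p.app n k := (map_one _).trans (mem_ker.1 hk).symm
    rcases h with rfl | rfl | rfl
    · exact assocElt_eq_one_of_app_eq hp hk rfl rfl <| NormalSubloop.assocElt_eq_one_iff.2 <| by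
        rw [one_mul, one_mul]
    · exact assocElt_eq_one_of_app_eq hp rfl hk rfl <| NormalSubloop.assocElt_eq_one_iff.2 <| by
        rw [one_mul, mul_one]
    · exact assocElt_eq_one_of_app_eq hp rfl rfl hk <| NormalSubloop.assocElt_eq_one_iff.2 <| by
        rw [mul_one, mul_one]
  discrete n k hk hv := by
    obtain ⟨z, hz₁, rfl⟩ := exists_pullback (p := p) (q := p) 1 k ((map_one _).trans hk.symm)
    have hzv : (pullback p p).map (initialVertex n) z = 1 := by
      refine pullback_ext ?_ ?_
      · rw [NatTrans.naturality_apply, hz₁, map_one, map_one]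
      · rw [NatTrans.naturality_apply, hv, map_one]
    have hz : unitHom (pullback p p) n z = 1 := by
      rw [← unitHom_map (initialVertex n), hzv, map_one]
    rw [eq_one_of_isNormalExtension hp hz₁ hz, map_one]

end SimplicialLoop

/-! ### The centralization of an extension -/

namespace NormalSubloop

variable {L M : Type u} [AlgLoop L] [AlgLoop M]

theorem map_mem_assocSet (φ : L →* M) {K : NormalSubloop L} {K' : NormalSubloop M}
    (h : ∀ k ∈ K, φ k ∈ K') {a : L} (ha : a ∈ K.assocSet) : φ a ∈ K'.assocSet := by
  obtain ⟨k, x, y, hk, ha⟩ := ha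
  refine ⟨φ k, φ x, φ y, h k hk, ?_⟩
  rcases ha with rfl | rfl | rfl <;> simp only [map_assocElt, true_or, or_true]

theorem exists_mem_assocSet_comap {φ : L →* M} (hφ : Function.Surjective φ) {K : NormalSubloop M}
    {a : M} (ha : a ∈ K.assocSet) : ∃ b ∈ (K.comap φ).assocSet, φ b = a := by
  obtain ⟨k, x, y, hk, ha⟩ := ha
  obtain ⟨k, rfl⟩ := hφ k
  obtain ⟨x, rfl⟩ := hφ x
  obtain ⟨y, rfl⟩ := hφ y
  rcases ha with rfl | rfl | rfl
  · exact ⟨_, ⟨k, x, y, hk, .inl rfl⟩, map_assocElt φ k x y⟩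
  · exact ⟨_, ⟨k, x, y, hk, .inr (.inl rfl)⟩, map_assocElt φ x k y⟩
  · exact ⟨_, ⟨k, x, y, hk, .inr (.inr rfl)⟩, map_assocElt φ x y k⟩

theorem mem_of_mem_associator {K : NormalSubloop L} {a : L} (ha : a ∈ K.associator) : a ∈ K := by
  refine normalClosure_le ?_ ha
  rintro a ⟨k, x, y, hk, ha⟩
  refine K.toQuot_eq_one_iff.1 ?_
  have hk : K.toQuot k = 1 := K.toQuot_eq_one hk
  rcases ha with rfl | rfl | rfl <;>
    rw [map_assocElt, hk, assocElt_eq_one_iff] <;> simp only [one_mul, mul_one]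

end NormalSubloop

namespace SimplicialLoop

open NormalSub

variable {A B E : SimplicialObject LoopCat.{u}} {n : SimplexCategoryᵒᵖ}

/-- Two vertices are joined by an edge in a fibre of `f`, that is, by an edge that `f` maps to a
degenerate edge. -/
def FiberJoined (f : A ⟶ B) (x y : A _⦋0⦌) : Prop :=
  ∃ (e : A _⦋1⦌) (b : B _⦋0⦌), f.app _ e = B.σ 0 b ∧ A.δ 1 e = x ∧ A.δ 0 e = y

theorem isReflexiveCompatible_fiberJoined (f : A ⟶ B) :
    IsReflexiveCompatible (FiberJoined f) where
  refl x := ⟨A.σ 0 x, f.app _ x, NatTrans.naturality_apply f _ x,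
    ConcreteCategory.congr_hom (A.δ_comp_σ_succ (i := (0 : Fin 1))) x,
    ConcreteCategory.congr_hom (A.δ_comp_σ_self (i := (0 : Fin 1))) x⟩
  mul := by
    rintro _ _ _ _ ⟨e, b, he, rfl, rfl⟩ ⟨e', b', he', rfl, rfl⟩
    exact ⟨e * e', b * b', by rw [map_mul, map_mul, he, he'], map_mul _ _ _, map_mul _ _ _⟩
  ldiv := by
    rintro _ _ _ _ ⟨e, b, he, rfl, rfl⟩ ⟨e', b', he', rfl, rfl⟩
    exact ⟨ldiv e e', ldiv b b', by rw [map_ldiv, map_ldiv, he, he'], map_ldiv _ _ _,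
      map_ldiv _ _ _⟩
  rdiv := by
    rintro _ _ _ _ ⟨e, b, he, rfl, rfl⟩ ⟨e', b', he', rfl, rfl⟩
    exact ⟨rdiv e e', rdiv b b', by rw [map_rdiv, map_rdiv, he, he'], map_rdiv _ _ _,
      map_rdiv _ _ _⟩

theorem fiberJoined_one_iff {f : A ⟶ B} {x : A _⦋0⦌} :
    FiberJoined f 1 x ↔ ∃ e : A _⦋1⦌, f.app _ e = 1 ∧ A.δ 1 e = 1 ∧ A.δ 0 e = x := by
  constructor
  · rintro ⟨e, b, he, h₁, h₀⟩
    have hb : b = 1 := by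
      calc b = B.δ 1 (B.σ 0 b) :=
            (ConcreteCategory.congr_hom (B.δ_comp_σ_succ (i := (0 : Fin 1))) b).symm
        _ = f.app _ (A.δ 1 e) := by rw [← he]; exact (NatTrans.naturality_apply f _ e).symm
        _ = 1 := by rw [h₁, map_one]
    exact ⟨e, by rw [he, hb, map_one], h₁, h₀⟩
  · rintro ⟨e, he, h₁, h₀⟩
    exact ⟨e, 1, by rw [he, map_one], h₁, h₀⟩

/-- The connected part `K₀` of the kernel `K` of `f`, as a normal subobject of the domain of `f`. -/
def kernelConnectedPart (f : A ⟶ B) : NormalSub A :=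
  sInf {ker f, verticesIn (isReflexiveCompatible_fiberJoined f).normalSubloop}

theorem mem_kernelConnectedPart {f : A ⟶ B} {x : A.obj n} :
    x ∈ (kernelConnectedPart f).obj n ↔
      f.app n x = 1 ∧ ∀ v : n ⟶ op ⦋0⦌, FiberJoined f 1 (A.map v x) := by
  simp only [← IsReflexiveCompatible.mem_normalSubloop (isReflexiveCompatible_fiberJoined f),
    ← mem_verticesIn, ← mem_ker]
  refine ⟨fun h => ⟨h _ ⟨_, .inl rfl, rfl⟩, h _ ⟨_, .inr rfl, rfl⟩⟩, ?_⟩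
  rintro ⟨h, h'⟩ _ ⟨_, rfl | rfl, rfl⟩
  exacts [h, h']

theorem mem_connectedPart_kernelObj {f : A ⟶ B} {x : (kernelObj f).obj n} :
    x ∈ (connectedPart (kernelObj f)).obj n ↔ x.1 ∈ (kernelConnectedPart f).obj n := by
  rw [mem_kernelConnectedPart, and_iff_right (mem_ker.1 x.2), mem_connectedPart]
  refine forall_congr' fun v => ?_
  rw [mem_componentVertices, fiberJoined_one_iff]
  constructor
  · rintro ⟨e, h₁, h₀⟩
    exact ⟨e.1, mem_ker.1 e.2, congrArg Subtype.val h₁, congrArg Subtype.val h₀⟩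
  · rintro ⟨e, he, h₁, h₀⟩
    exact ⟨⟨e, mem_ker.2 he⟩, Subtype.ext h₁, Subtype.ext h₀⟩

/-- `[K,A,A] ∨ K₀` as a normal subobject of `A`, where `K` is the kernel of `f`. -/
def centralizationKernel (f : A ⟶ B) : NormalSub A :=
  (ker f).associator ⊔ kernelConnectedPart f

theorem centralizationKernel_le_ker (f : A ⟶ B) : centralizationKernel f ≤ ker f :=
  NormalSub.sup_le (fun _ _ => NormalSubloop.mem_of_mem_associator)
    fun _ _ hx => mem_ker.2 (mem_kernelConnectedPart.1 hx).1

theorem centralizationKernel_le_associator_sup_connectedPart (f : A ⟶ B) :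
    centralizationKernel f ≤ (top A).associator ⊔ connectedPart A := by
  refine NormalSub.sup_le (fun n x hx => ?_) (fun n x hx => ?_)
  · exact NormalSub.le_sup_left _ _ _ _ <|
      NormalSubloop.map_mem_associator (MonoidHom.id _) (fun k _ => NormalSubloop.mem_top k) hx
  · refine NormalSub.le_sup_right _ _ _ _ (mem_connectedPart.2 fun v => ?_)
    obtain ⟨e, -, -, h⟩ := (mem_kernelConnectedPart.1 hx).2 v
    exact mem_componentVertices.2 ⟨e, h⟩

theorem mem_hopfDenominator {f : A ⟶ B} {x : (kernelObj f).obj n} :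
    x ∈ (hopfDenominator f).obj n ↔ x.1 ∈ (centralizationKernel f).obj n := by
  refine mem_sup.trans (Iff.trans ⟨?_, ?_⟩ mem_sup.symm)
  · rintro ⟨a, ha, k, hk, rfl⟩
    exact ⟨a.1, ha, k.1, mem_connectedPart_kernelObj.1 hk, rfl⟩
  · rintro ⟨a, ha, k, hk, hx⟩
    exact ⟨⟨a, NormalSubloop.mem_of_mem_associator ha⟩, ha,
      ⟨k, mem_ker.2 (mem_kernelConnectedPart.1 hk).1⟩, mem_connectedPart_kernelObj.2 hk,
      Subtype.ext hx⟩

theorem mem_hopfNumerator {f : A ⟶ B} {x : (kernelObj f).obj n} :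
    x ∈ (hopfNumerator f).obj n ↔ unitHom A n x.1 = 1 :=
  mem_associator_sup_connectedPart

theorem hopfDenominator_le_hopfNumerator (f : A ⟶ B) : hopfDenominator f ≤ hopfNumerator f :=
  fun n x hx => centralizationKernel_le_associator_sup_connectedPart f n x.1
    (mem_hopfDenominator.1 hx)

theorem IsCentral.centralizationKernel_le_ker {p : E ⟶ B} (hp : IsCentral p) {f : A ⟶ B}
    {g : A ⟶ E} (hg : g ≫ p = f) : centralizationKernel f ≤ ker g := by
  have hker {n} {k : A.obj n} (hk : f.app n k = 1) : p.app n (g.app n k) = 1 :=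
    (app_app_of_comp_eq hg k).trans hk
  refine NormalSub.sup_le (fun n x hx => ?_) (fun n x hx => mem_ker.2 ?_)
  · refine NormalSubloop.normalClosure_le (fun a ha => mem_ker.2 (hp.assoc n _ ?_)) hx
    exact NormalSubloop.map_mem_assocSet (g.app n).hom
      (fun k hk => mem_ker.2 (hker (mem_ker.1 hk))) ha
  · obtain ⟨hfx, hx⟩ := mem_kernelConnectedPart.1 hx
    obtain ⟨e, he, h₁, h₀⟩ := fiberJoined_one_iff.1 (hx (initialVertex n))
    refine hp.discrete n _ (hker hfx) ?_
    calc E.map (initialVertex n) (g.app n x)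
        = g.app _ (A.δ 0 e) := by rw [h₀, NatTrans.naturality_apply]
      _ = E.δ 0 (g.app _ e) := NatTrans.naturality_apply g _ e
      _ = E.δ 1 (g.app _ e) := hp.δ_eq (hker he)
      _ = g.app _ (A.δ 1 e) := (NatTrans.naturality_apply g _ e).symm
      _ = 1 := by rw [h₁, map_one]

/-- The centralization `A/([K,A,A] ∨ K₀) ⟶ B` of `f : A ⟶ B`, where `K` is the kernel of `f`. -/
def centralization (f : A ⟶ B) : (centralizationKernel f).quotient ⟶ B :=
  (centralizationKernel f).desc f (centralizationKernel_le_ker f)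

theorem quotientMap_centralization (f : A ⟶ B) :
    (centralizationKernel f).quotientMap ≫ centralization f = f :=
  quotientMap_desc _ _ _

theorem isCentral_centralization (f : A ⟶ B) : IsCentral (centralization f) where
  assoc n a ha := by
    obtain ⟨b, hb, rfl⟩ := NormalSubloop.exists_mem_assocSet_comap
      ((centralizationKernel f).quotientMap_surjective n) ha
    rw [quotientMap_eq_one_iff]
    exact NormalSub.le_sup_left _ _ _ _ (NormalSubloop.subset_normalClosure _ hb)
  discrete n k hk hv := by
    obtain ⟨x, rfl⟩ := (centralizationKernel f).quotientMap_surjective n k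
    rw [← NatTrans.naturality_apply, quotientMap_eq_one_iff] at hv
    rw [quotientMap_eq_one_iff]
    let x' : (kernelObj f).obj n := ⟨x, mem_ker.2 hk⟩
    have hx' : x' ∈ (hopfDenominator f).obj n :=
      (mem_iff_initialVertex_mem (NormalSub.le_sup_right _ _)).2 (mem_hopfDenominator.2 hv)
    exact mem_hopfDenominator.1 hx'

theorem isNormalExtension_centralization {f : A ⟶ B} (hf : ∀ n, Function.Surjective (f.app n)) :
    IsNormalExtension reflectionAdj (centralization f) := by
  refine (isCentral_centralization f).isNormalExtension fun n b => ?_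
  obtain ⟨x, rfl⟩ := hf n b
  exact ⟨_, app_app_of_comp_eq (quotientMap_centralization f) x⟩

theorem isWeaklyUniversalNormalExtension_centralization {f : A ⟶ B}
    (hf : ∀ n, Function.Surjective (f.app n))
    (h : ∀ ⦃E : SimplicialObject LoopCat.{u}⦄ (p : E ⟶ B), IsNormalExtension reflectionAdj p →
      ∃ g : A ⟶ E, g ≫ p = f) :
    IsWeaklyUniversalNormalExtension reflectionAdj (centralization f) := by
  refine ⟨isNormalExtension_centralization hf, fun E p hp => ?_⟩
  obtain ⟨g, hg⟩ := h p hp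
  have hle := (isCentral_of_isNormalExtension hp).centralizationKernel_le_ker hg
  have := epi_of_surjective (centralizationKernel f).quotientMap_surjective
  refine ⟨(centralizationKernel f).desc g hle, ?_⟩
  rw [← cancel_epi (centralizationKernel f).quotientMap, ← Category.assoc, quotientMap_desc, hg,
    quotientMap_centralization]

end SimplicialLoop

/-! ### The Hopf formula -/

namespace SimplicialLoop

open NormalSub

variable {A B E : SimplicialObject LoopCat.{u}} {n : SimplexCategoryᵒᵖ}

/-- The trivial morphism. -/
def trivialHom (A B : SimplicialObject LoopCat.{u}) : A ⟶ B where
  app n := LoopCat.ofHom (1 : A.obj n →* B.obj n)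
  naturality _ _ θ := by
    ext _
    exact (map_one (B.map θ).hom).symm

/-- The morphism `k ↦ (1, k)` from the kernel of `p` to the kernel pair of `p`. -/
noncomputable def kernelInr (p : E ⟶ B) : kernelObj p ⟶ pullback p p :=
  pullback.lift (trivialHom _ _) (ker p).ι <| by
    ext n k
    exact (map_one (p.app n).hom).trans (mem_ker.1 k.2).symm

theorem fst_kernelInr {p : E ⟶ B} (k : (kernelObj p).obj n) :
    (pullback.fst p p).app n ((kernelInr p).app n k) = 1 :=
  app_app_of_comp_eq (pullback.lift_fst _ _ _) k

theorem snd_kernelInr {p : E ⟶ B} (k : (kernelObj p).obj n) :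
    (pullback.snd p p).app n ((kernelInr p).app n k) = k.1 :=
  app_app_of_comp_eq (pullback.lift_snd _ _ _) k

theorem kernelInr_mul_diagonal {p : E ⟶ B} (k : (kernelObj p).obj n)
    {z : (pullback p p).obj n}
    (hk : k.1 = rdiv ((pullback.snd p p).app n z) ((pullback.fst p p).app n z)) :
    (kernelInr p).app n k * (pullback.diagonal p).app n ((pullback.fst p p).app n z) = z := by
  refine pullback_ext ?_ ?_
  · rw [map_mul, fst_kernelInr, one_mul]
    exact app_app_of_comp_eq (pullback.diagonal_fst p) _
  · rw [map_mul, snd_kernelInr, hk,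
      app_app_of_comp_eq (pullback.diagonal_snd p) ((pullback.fst p p).app n z)]
    exact rdiv_mul _ _

theorem mem_galoisGroup {p : E ⟶ B} {z : (pullback p p).obj n} :
    unitHom (pullback p p) n z ∈ MonoidHom.ker
      ((simplicialLoopReflector.map (pullback.fst p p)).hom.prod
        (simplicialLoopReflector.map (pullback.snd p p)).hom) ↔
      unitHom E n ((pullback.fst p p).app n z) = 1 ∧
        unitHom E n ((pullback.snd p p).app n z) = 1 := by
  rw [unitHom_app, unitHom_app]
  exact Prod.ext_iff

/-- The morphism from `K ∧ ([E,E,E] ∨ E₀)`, where `K` is the kernel of `p`, to the Galois group of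
`p` that sends `k` to the class of `(1, k)`. -/
noncomputable def toGaloisGroup (p : E ⟶ B) :
    (hopfNumerator p).toSimplicial ⟶ grpInclusion.obj (galoisGroup simplicialLoopReflector p) where
  app n := ConcreteCategory.ofHom (C := LoopCat)
    (X := LoopCat.of {x // x ∈ (hopfNumerator p).obj n})
    (Y := (grpInclusion.obj (galoisGroup simplicialLoopReflector p)).obj n) <|
    ((unitHom (pullback p p) n).comp
      (((kernelInr p).app n).hom.comp ((hopfNumerator p).obj n).subtype)).codRestrict _ fun k => by
        refine mem_galoisGroup.2 ⟨?_, ?_⟩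
        · exact (congrArg _ (fst_kernelInr k.1)).trans (map_one _)
        · exact (congrArg _ (snd_kernelInr k.1)).trans (mem_hopfNumerator.1 k.2)
  naturality m n θ := by
    ext k
    refine Subtype.ext ?_
    refine (congrArg (unitHom (pullback p p) n) ?_).trans (unitHom_map θ _)
    exact NatTrans.naturality_apply (kernelInr p) θ k.1

theorem isIso_toGaloisGroup {p : E ⟶ B} (hp : IsNormalExtension reflectionAdj p) :
    IsIso (toGaloisGroup p) := by
  refine isIso_of_bijective _ fun n =>
    ⟨injective_of_map_eq_one ((toGaloisGroup p).app n).hom fun k hk => ?_, ?_⟩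
  · have h : (kernelInr p).app n k.1 = 1 :=
      eq_one_of_isNormalExtension hp (fst_kernelInr k.1) (congrArg Subtype.val hk)
    refine Subtype.ext (Subtype.ext ?_)
    exact (snd_kernelInr k.1).symm.trans ((congrArg _ h).trans (map_one _))
  · rintro ⟨a, ha⟩
    obtain ⟨z, rfl⟩ := unitHom_surjective (pullback p p) n a
    obtain ⟨h₁, h₂⟩ := mem_galoisGroup.1 ha
    let k : (kernelObj p).obj n :=
      ⟨rdiv ((pullback.snd p p).app n z) ((pullback.fst p p).app n z),
        mem_ker.2 ((map_rdiv_eq_one_iff _).2 (app_fst_eq_app_snd z).symm)⟩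
    have hk : k ∈ (hopfNumerator p).obj n :=
      mem_hopfNumerator.2 ((map_rdiv_eq_div _ _ _).trans (by rw [h₁, h₂, div_one]))
    refine ⟨⟨k, hk⟩, Subtype.ext ?_⟩
    calc unitHom _ n ((kernelInr p).app n k)
        = unitHom _ n ((kernelInr p).app n k *
            (pullback.diagonal p).app n ((pullback.fst p p).app n z)) := by
          rw [map_mul, unitHom_app_eq_one (pullback.diagonal p) h₁, mul_one]
      _ = unitHom _ n z := by rw [kernelInr_mul_diagonal k rfl]

/-- The morphism between the subobjects `K ∧ ([A,A,A] ∨ A₀)` of the kernels of `f` and `p` induced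
by a morphism over `B`. -/
def mapHopfNumerator {f : A ⟶ B} {p : E ⟶ B} (g : A ⟶ E) (h : g ≫ p = f) :
    (hopfNumerator f).toSimplicial ⟶ (hopfNumerator p).toSimplicial :=
  restrict (restrict g (ker f) (ker p) fun _ _ hx =>
    mem_ker.2 ((app_app_of_comp_eq h _).trans (mem_ker.1 hx))) _ _ fun _ _ hx =>
      mem_hopfNumerator.2 (unitHom_app_eq_one g (mem_hopfNumerator.1 hx))

theorem mapHopfNumerator_comp_eq_id {f : A ⟶ B} {p : E ⟶ B}
    (hf : IsNormalExtension reflectionAdj f) {u : A ⟶ E} (hu : u ≫ p = f) {v : E ⟶ A}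
    (hv : v ≫ f = p) : mapHopfNumerator u hu ≫ mapHopfNumerator v hv = 𝟙 _ := by
  have huv : (u ≫ v) ≫ f = 𝟙 A ≫ f := by rw [Category.assoc, hv, hu, Category.id_comp]
  ext n x
  exact Subtype.ext (Subtype.ext
    (app_eq_of_unitHom_eq_one hf huv (mem_hopfNumerator.1 x.2)))

theorem nonempty_hopfNumerator_iso {p : E ⟶ B} {q : A ⟶ B}
    (hp : IsWeaklyUniversalNormalExtension reflectionAdj p)
    (hq : IsWeaklyUniversalNormalExtension reflectionAdj q) :
    Nonempty ((hopfNumerator p).toSimplicial ≅ (hopfNumerator q).toSimplicial) := by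
  obtain ⟨u, hu⟩ := hp.exists_hom q hq.isNormal
  obtain ⟨v, hv⟩ := hq.exists_hom p hp.isNormal
  exact ⟨⟨mapHopfNumerator u hu, mapHopfNumerator v hv,
    mapHopfNumerator_comp_eq_id hp.isNormal hu hv, mapHopfNumerator_comp_eq_id hq.isNormal hv hu⟩⟩

theorem unitHom_eq_one_of_quotientMap {N : NormalSub A} (hN : N ≤ ker (reflectionAdj.unit.app A))
    {x : A.obj n} (hx : unitHom N.quotient n (N.quotientMap.app n x) = 1) : unitHom A n x = 1 :=
  app_eq_one_of_unitHom_eq_one (N.desc (reflectionAdj.unit.app A) hN) hx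

/-- The morphism from `K ∧ ([A,A,A] ∨ A₀)`, where `K` is the kernel of `f`, to the corresponding
subobject for the centralization of `f`. -/
def toHopfNumeratorCentralization (f : A ⟶ B) :
    (hopfNumerator f).toSimplicial ⟶ (hopfNumerator (centralization f)).toSimplicial :=
  mapHopfNumerator (centralizationKernel f).quotientMap (quotientMap_centralization f)

theorem toHopfNumeratorCentralization_surjective (f : A ⟶ B) (n : SimplexCategoryᵒᵖ) :
    Function.Surjective ((toHopfNumeratorCentralization f).app n) := by
  rintro ⟨⟨y, hy⟩, hy'⟩
  obtain ⟨x, rfl⟩ := (centralizationKernel f).quotientMap_surjective n y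
  have hle : centralizationKernel f ≤ ker (reflectionAdj.unit.app A) := fun n x hx =>
    associator_sup_connectedPart_le_ker_unit n x
      (centralizationKernel_le_associator_sup_connectedPart f n x hx)
  have hx : unitHom A n x = 1 := unitHom_eq_one_of_quotientMap hle (mem_hopfNumerator.1 hy')
  exact ⟨⟨⟨x, hy⟩, mem_hopfNumerator.2 hx⟩, rfl⟩

theorem toHopfNumeratorCentralization_eq_one_iff {f : A ⟶ B}
    {x : (hopfNumerator f).toSimplicial.obj n} :
    (toHopfNumeratorCentralization f).app n x = 1 ↔ x.1 ∈ (hopfDenominator f).obj n := by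
  rw [mem_hopfDenominator, ← quotientMap_eq_one_iff]
  exact Subtype.ext_iff.trans Subtype.ext_iff

theorem nonempty_hopfQuotient_iso (f : A ⟶ B) :
    Nonempty (hopfQuotient f ≅ (hopfNumerator (centralization f)).toSimplicial) := by
  have hle : (hopfDenominator f).comap (hopfNumerator f).ι ≤
      ker (toHopfNumeratorCentralization f) :=
    fun _ _ hx => mem_ker.2 (toHopfNumeratorCentralization_eq_one_iff.2 hx)
  have := isIso_desc _ (toHopfNumeratorCentralization_surjective f) hle fun _ _ hx =>
    toHopfNumeratorCentralization_eq_one_iff.1 (mem_ker.1 hx)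
  let e := asIso (NormalSub.desc _ _ hle)
  exact ⟨e⟩

end SimplicialLoop

open SimplicialLoop

theorem mainTheorem10_general {B P : SimplicialObject LoopCat.{u}} (f : P ⟶ B)
    (hf : IsRegularEpi f)
    (hP : ∀ ⦃E : SimplicialObject LoopCat.{u}⦄ (p : E ⟶ B), IsNormalExtension reflectionAdj p →
      ∃ g : P ⟶ E, g ≫ p = f) :
    (∃ (E : SimplicialObject LoopCat.{u}) (p : E ⟶ B),
      IsWeaklyUniversalNormalExtension reflectionAdj p) ∧
    hopfDenominator f ≤ hopfNumerator f ∧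
    ∀ (E : SimplicialObject LoopCat.{u}) (p : E ⟶ B),
      IsWeaklyUniversalNormalExtension reflectionAdj p →
        Nonempty (grpInclusion.obj (galoisGroup simplicialLoopReflector p) ≅ hopfQuotient f) := by
  have hc : IsWeaklyUniversalNormalExtension reflectionAdj (centralization f) :=
    isWeaklyUniversalNormalExtension_centralization (isRegularEpi_iff_surjective.1 hf) hP
  refine ⟨⟨_, _, hc⟩, hopfDenominator_le_hopfNumerator f, fun E p hp => ?_⟩
  have := isIso_toGaloisGroup hp.isNormal
  obtain ⟨e⟩ := nonempty_hopfNumerator_iso hp hc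
  obtain ⟨e'⟩ := nonempty_hopfQuotient_iso f
  exact ⟨(asIso (toGaloisGroup p)).symm ≪≫ e ≪≫ e'.symm⟩

theorem mainTheorem10 {B P : SimplicialObject LoopCat.{u}} (f : P ⟶ B)
    (hf : IsRegularEpi f) (hP : IsRegularProjective P) :
    (∃ (E : SimplicialObject LoopCat.{u}) (p : E ⟶ B),
      IsWeaklyUniversalNormalExtension reflectionAdj p) ∧
    hopfDenominator f ≤ hopfNumerator f ∧
    ∀ (E : SimplicialObject LoopCat.{u}) (p : E ⟶ B),
      IsWeaklyUniversalNormalExtension reflectionAdj p →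
        Nonempty (grpInclusion.obj (galoisGroup simplicialLoopReflector p) ≅ hopfQuotient f) :=
  mainTheorem10_general f hf fun _ p hp => hP p f hp.isRegularEpi
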